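/- Let $l,m,r\ge 1$ be integers, let $\mathcal M_{l,m}$ be the space of real $l\times m$ matrices with the Frobenius scalar product $\langle A,B\rangle=\mathrm{Tr}(A^TB)$ and norm $\|\cdot\|$, and let $\mathscr M=\{R\in\mathcal M_{l,m}:\operatorname{rank}R=r\}$. For $A\in\mathcal M_{l,m}$ let $\sigma_1(A)\ge\sigma_2(A)\ge\dots\ge 0$ be its singular values (with $\sigma_k(A)=0$ for $k>\operatorname{rank}A$), and let $\Pi_{\mathscr M}(A)$ be the unique matrix in $\mathscr M$ at minimal distance from $A$, which exists when $\sigma_r(A)>\sigma_{r+1}(A)$. For $R\in\mathscr M$ let $\mathcal T(R)$ be the tangent space of $\mathscr M$ at $R$ and $\Pi_{\mathcal T(R)}$ the orthogonal projection of $\mathcal M_{l,m}$ onto it. Let $T\ge 0$ and let $\mathcal L(t,\cdot):\mathcal M_{l,m}\to\mathcal M_{l,m}$ for $t\in[0,T]$. Suppose that $\mathfrak R$ and $R$ are defined and differentiable on $[0,T]$ (one-sidedly at the end points), that $\dot{\mathfrak R}=\mathcal L(t,\mathfrak R)$ on $[0,T]$, and that $R$ is the dynamically orthogonal (DO) approximation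 of $\mathfrak R$, that is, $R(t)\in\mathscr M$ and $\dot R=\Pi_{\mathcal T(R)}(\mathcal L(t,R))$ on $[0,T]$, and $R(0)=\Pi_{\mathscr M}(\mathfrak R(0))$. Assume that 1. there is a constant $K$ with $\|\mathcal L(t,A)-\mathcal L(t,B)\|\le K\|A-B\|$ for all $t\in[0,T]$ and all $A,B\in\mathcal M_{l,m}$; 2. $\sigma_r(\mathfrak R(t))>\sigma_{r+1}(\mathfrak R(t))$ for all $t\in[0,T]$; and that the constant $$\eta=K+\sup_{t\in[0,T]}\frac{2}{\sigma_r(\mathfrak R(t))}\|\mathcal L(t,\mathfrak R(t))\|$$ is finite (which is automatic if $\mathcal L$ is continuous). Then, for all $t\in[0,T]$, $$\|R(t)-\Pi_{\mathscr M}(\mathfrak R(t))\|\le\int_0^t\|\mathfrak R(s)-\Pi_{\mathscr M}(\mathfrak R(s))\|\left(K+\frac{\|\mathcal L(s,\mathfrak R(s))\|}{\sigma_r(\mathfrak R(s))-\sigma_{r+1}(\mathfrak R(s))}\right)e^{\eta(t-s)}\,ds,$$ where the integrand is integrable on $[0,t]$. -/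

import Mathlib

open Set Filter Topology MeasureTheory
open scoped ContDiff Matrix

attribute [local instance] Matrix.frobeniusNormedAddCommGroup Matrix.frobeniusNormedSpace

noncomputable section

namespace LowRank

/-- The Frobenius scalar product `⟨A, B⟩ = Tr(Aᵀ B)` on `l`-by-`m` real matrices; its norm is the
Frobenius norm. -/
@[reducible] def frobeniusInnerProductSpace (l m : ℕ) :
    InnerProductSpace ℝ (Matrix (Fin l) (Fin m) ℝ) where
  toNormedSpace := Matrix.frobeniusNormedSpace
  inner A B := (Aᵀ * B).trace
  norm_sq_eq_re_inner A := by
    rw [Matrix.frobenius_norm_def, ← Real.rpow_natCast, ← Real.rpow_mul (by positivity)]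
    norm_num [Matrix.trace, Matrix.mul_apply]
    rw [Finset.sum_comm]
    simp [pow_two]
  conj_inner_symm A B := by
    simp only [conj_trivial]
    rw [← Matrix.trace_transpose, Matrix.transpose_mul, Matrix.transpose_transpose]
  add_left A B C := by simp [Matrix.add_mul]
  smul_left A B c := by simp

attribute [local instance] frobeniusInnerProductSpace

variable {l m : ℕ}

/-- The `k`-th singular value `σ_k(A)`, `k ≥ 1`, in decreasing order with multiplicity; it is `0`
for `k > rank A`. -/
def sigma (k : ℕ) (A : Matrix (Fin l) (Fin m) ℝ) : ℝ :=
  (Matrix.toEuclideanLin A).singularValues (k - 1)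

/-- `P` is a point of the manifold of rank `r` matrices at minimal Frobenius distance from `A`. -/
def IsNearest (r : ℕ) (A P : Matrix (Fin l) (Fin m) ℝ) : Prop :=
  P.rank = r ∧ ∀ Q : Matrix (Fin l) (Fin m) ℝ, Q.rank = r → ‖A - P‖ ≤ ‖A - Q‖

open Classical in
/-- The orthogonal projection `Π_M(A)` onto the manifold `M` of rank `r` matrices: the unique
nearest point of `M`, where there is exactly one (and `0` elsewhere). -/
def projM (r : ℕ) (A : Matrix (Fin l) (Fin m) ℝ) : Matrix (Fin l) (Fin m) ℝ :=
  if h : ∃! P, IsNearest r A P then h.choose else 0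

/-- The velocities at `R` of smooth curves drawn on the manifold of rank `r` matrices. -/
def velocities (r : ℕ) (R : Matrix (Fin l) (Fin m) ℝ) : Set (Matrix (Fin l) (Fin m) ℝ) :=
  {X | ∃ γ : ℝ → Matrix (Fin l) (Fin m) ℝ, ContDiffAt ℝ ∞ γ 0 ∧
    (∀ᶠ t in 𝓝 0, (γ t).rank = r) ∧ γ 0 = R ∧ HasDerivAt γ X 0}

/-- The tangent space at `R` of the manifold of rank `r` matrices. At a matrix of rank `r` the
velocities already form a linear subspace, so that the span adds nothing. -/
def tangentSpace (r : ℕ) (R : Matrix (Fin l) (Fin m) ℝ) :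
    Submodule ℝ (Matrix (Fin l) (Fin m) ℝ) :=
  Submodule.span ℝ (velocities r R)

/-- The orthogonal projection `Π_{T(R)}` onto the tangent space at `R`. -/
def projT (r : ℕ) (R X : Matrix (Fin l) (Fin m) ℝ) : Matrix (Fin l) (Fin m) ℝ :=
  (tangentSpace r R).starProjection X

/-- `F` solves `F' = 𝓛(t, F)` on `[0, T]`. -/
def IsFullSolution (T : ℝ)
    (L : ℝ → Matrix (Fin l) (Fin m) ℝ → Matrix (Fin l) (Fin m) ℝ)
    (F : ℝ → Matrix (Fin l) (Fin m) ℝ) : Prop :=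
  ∀ t ∈ Icc 0 T, HasDerivWithinAt F (L t (F t)) (Icc 0 T) t

/-- `R` is defined on `[0, T]` as the DO approximation of rank `r` of the solution `F`: it lives on
the manifold of rank `r` matrices, `R' = Π_{T(R)}(𝓛(t, R))` and `R(0) = Π_M(F(0))`. -/
structure IsDOSolution (r : ℕ) (T : ℝ)
    (L : ℝ → Matrix (Fin l) (Fin m) ℝ → Matrix (Fin l) (Fin m) ℝ)
    (F R : ℝ → Matrix (Fin l) (Fin m) ℝ) : Prop where
  rank_eq : ∀ t ∈ Icc 0 T, (R t).rank = r
  deriv_eq : ∀ t ∈ Icc 0 T, HasDerivWithinAt R (projT r (R t) (L t (R t))) (Icc 0 T) t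
  init : R 0 = projM r (F 0)

/-- The values over `t ∈ [0, T]` of `2 ‖𝓛(t, F(t))‖ / σ_r(F(t))`. -/
def growthValues (r : ℕ) (T : ℝ)
    (L : ℝ → Matrix (Fin l) (Fin m) ℝ → Matrix (Fin l) (Fin m) ℝ)
    (F : ℝ → Matrix (Fin l) (Fin m) ℝ) : Set ℝ :=
  (fun t => 2 / sigma r (F t) * ‖L t (F t)‖) '' Icc 0 T

/-- The growth rate `η = K + sup_{t ∈ [0, T]} 2 ‖𝓛(t, F(t))‖ / σ_r(F(t))`. -/
def growthRate (r : ℕ) (K T : ℝ)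
    (L : ℝ → Matrix (Fin l) (Fin m) ℝ → Matrix (Fin l) (Fin m) ℝ)
    (F : ℝ → Matrix (Fin l) (Fin m) ℝ) : ℝ :=
  K + sSup (growthValues r T L F)

/-- The integrand of the error bound at time `t`. -/
def errorIntegrand (r : ℕ) (K T : ℝ)
    (L : ℝ → Matrix (Fin l) (Fin m) ℝ → Matrix (Fin l) (Fin m) ℝ)
    (F : ℝ → Matrix (Fin l) (Fin m) ℝ) (t s : ℝ) : ℝ :=
  ‖F s - projM r (F s)‖ * (K + ‖L s (F s)‖ / (sigma r (F s) - sigma (r + 1) (F s))) *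
    Real.exp (growthRate r K T L F * (t - s))

end LowRank

end

/-! Write P(t) for the best rank r approximation of the full solution 𝔉(t) (`F`), N = 𝔉 - P and e =
R - P. The error e satisfies a differential inequality to which Grönwall applies, once P' is
compared with the velocity of R. Differentiating the conditions RᵀN = 0 and RNᵀ = 0 that
characterize truncation gives (1 - W) P' = Π_{T(P)} 𝔉', where W is the Weingarten map in the normal
direction N. Since ‖W‖ ≤ σ_{r+1}/σ_r < 1, P' exists and differs from Π_{T(P)} 𝔉' by at most ‖N‖ ‖𝔉'‖
/ (σ_r - σ_{r+1}) (`exists_hasDerivWithinAt_projM`). Tangent projections at two matrices of rank r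
differ by at most 2‖e‖/σ_r(𝔉) (`norm_projT_sub_projT_le`), and the Lipschitz bound costs K(‖e‖ +
‖N‖). Hence ‖e'‖ ≤ η‖e‖ + ‖N‖(K + ‖𝓛‖/(σ_r - σ_{r+1})). Column and row spaces are handled through
the projections BH and HB built from a Moore–Penrose inverse H, so that most arguments become matrix
algebra. -/

noncomputable section

namespace LowRank

attribute [local instance] frobeniusInnerProductSpace

/-! ### Orthogonal projections and Moore–Penrose inverses in the Frobenius norm. -/

section Frobenius

variable {k l m n : ℕ}

theorem inner_eq_trace (A B : Matrix (Fin l) (Fin m) ℝ) : inner ℝ A B = (Aᵀ * B).trace := rfl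

theorem norm_sq_eq_trace (A : Matrix (Fin l) (Fin m) ℝ) : ‖A‖ ^ 2 = (Aᵀ * A).trace := by
  rw [← inner_eq_trace, real_inner_self_eq_norm_sq]

theorem norm_add_sq_of_trace_eq_zero {A B : Matrix (Fin l) (Fin m) ℝ} (h : (Aᵀ * B).trace = 0) :
    ‖A + B‖ ^ 2 = ‖A‖ ^ 2 + ‖B‖ ^ 2 := by
  rw [norm_add_sq_real, inner_eq_trace, h]; ring

/-- Left multiplication by `M` is bounded by `c` in the Frobenius norm: the operator norm of `M` is
at most `c`. -/
def OpBound (c : ℝ) (M : Matrix (Fin l) (Fin m) ℝ) : Prop :=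
  0 ≤ c ∧ ∀ (k : ℕ) (Y : Matrix (Fin m) (Fin k) ℝ), ‖M * Y‖ ≤ c * ‖Y‖

/-- Duality: ‖MᵀY‖² = ⟨Y, M(MᵀY)⟩ ≤ ‖Y‖ · c‖MᵀY‖, then divide by ‖MᵀY‖. -/
theorem OpBound.transpose {c : ℝ} {M : Matrix (Fin l) (Fin m) ℝ} (h : OpBound c M) :
    OpBound c Mᵀ := by
  refine ⟨h.1, fun k Y => ?_⟩
  rcases (norm_nonneg (Mᵀ * Y)).eq_or_lt with h0 | h0
  · rw [← h0]
    exact mul_nonneg h.1 (norm_nonneg _)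
  · have h1 := h.2 k (Mᵀ * Y)
    have h2 : ‖Mᵀ * Y‖ ^ 2 = inner ℝ Y (M * (Mᵀ * Y)) := by
      rw [norm_sq_eq_trace, inner_eq_trace, Matrix.transpose_mul, Matrix.transpose_transpose,
        Matrix.mul_assoc]
    have h3 := real_inner_le_norm Y (M * (Mᵀ * Y))
    have h4 : ‖Mᵀ * Y‖ * ‖Mᵀ * Y‖ ≤ (c * ‖Y‖) * ‖Mᵀ * Y‖ := by
      nlinarith [mul_le_mul_of_nonneg_left h1 (norm_nonneg Y)]
    exact le_of_mul_le_mul_right h4 h0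

theorem OpBound.norm_mul_right_le {c : ℝ} {M : Matrix (Fin l) (Fin m) ℝ} (h : OpBound c M)
    (Y : Matrix (Fin k) (Fin l) ℝ) : ‖Y * M‖ ≤ c * ‖Y‖ := by
  have := h.transpose.2 k Yᵀ
  rwa [← Matrix.transpose_mul, Matrix.frobenius_norm_transpose,
    Matrix.frobenius_norm_transpose] at this

/-- `P` is the matrix of an orthogonal projection. -/
structure IsOrthProj (P : Matrix (Fin n) (Fin n) ℝ) : Prop where
  idem : P * P = P
  symm : Pᵀ = P

namespace IsOrthProj

variable {P P' : Matrix (Fin n) (Fin n) ℝ}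

theorem one_sub (h : IsOrthProj P) : IsOrthProj (1 - P) where
  idem := by rw [sub_mul, mul_sub, mul_sub, h.idem]; simp
  symm := by rw [Matrix.transpose_sub, h.symm, Matrix.transpose_one]

theorem mul_one_sub (h : IsOrthProj P) : P * (1 - P) = 0 := by
  rw [mul_sub, h.idem, mul_one, sub_self]

theorem one_sub_mul (h : IsOrthProj P) : (1 - P) * P = 0 := by
  rw [sub_mul, h.idem, one_mul, sub_self]

theorem norm_sq_add_norm_sq (h : IsOrthProj P) (Y : Matrix (Fin n) (Fin k) ℝ) :
    ‖P * Y‖ ^ 2 + ‖(1 - P) * Y‖ ^ 2 = ‖Y‖ ^ 2 := by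
  rw [← norm_add_sq_of_trace_eq_zero, ← Matrix.add_mul, add_sub_cancel, Matrix.one_mul]
  rw [Matrix.transpose_mul, h.symm, Matrix.mul_assoc, ← Matrix.mul_assoc P, h.mul_one_sub]
  simp

theorem opBound (h : IsOrthProj P) : OpBound 1 P := by
  refine ⟨zero_le_one, fun k Y => ?_⟩
  have := h.norm_sq_add_norm_sq Y
  rw [one_mul]
  exact le_of_sq_le_sq (by nlinarith [sq_nonneg ‖(1 - P) * Y‖]) (norm_nonneg _)

theorem norm_mul_le (h : IsOrthProj P) (Y : Matrix (Fin n) (Fin k) ℝ) : ‖P * Y‖ ≤ ‖Y‖ := by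
  simpa using h.opBound.2 k Y

theorem norm_mul_right_le (h : IsOrthProj P) (Y : Matrix (Fin k) (Fin n) ℝ) : ‖Y * P‖ ≤ ‖Y‖ := by
  simpa using h.opBound.norm_mul_right_le Y

/-- Apart from the trace of `P`, which is its rank, the right side is symmetric in `P` and `P'`. -/
theorem norm_sq_one_sub_mul (h : IsOrthProj P) (h' : IsOrthProj P') :
    ‖(1 - P') * P‖ ^ 2 = P.trace - (P' * P).trace := by
  rw [norm_sq_eq_trace, Matrix.transpose_mul, h.symm, h'.one_sub.symm, Matrix.mul_assoc,
    ← Matrix.mul_assoc (1 - P'), h'.one_sub.idem, Matrix.trace_mul_comm, Matrix.mul_assoc, h.idem,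
    Matrix.sub_mul, Matrix.one_mul, Matrix.trace_sub]

/-- Two orthogonal projections of the same rank deviate equally from each other. -/
theorem norm_one_sub_mul_comm (h : IsOrthProj P) (h' : IsOrthProj P')
    (ht : P.trace = P'.trace) : ‖(1 - P') * P‖ = ‖(1 - P) * P'‖ := by
  rw [← sq_eq_sq₀ (norm_nonneg _) (norm_nonneg _), h.norm_sq_one_sub_mul h',
    h'.norm_sq_one_sub_mul h, ht, Matrix.trace_mul_comm]

theorem norm_mul_one_sub (h : IsOrthProj P) (h' : IsOrthProj P') :
    ‖P * (1 - P')‖ = ‖(1 - P') * P‖ := by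
  rw [← Matrix.frobenius_norm_transpose, Matrix.transpose_mul, h.symm, h'.one_sub.symm]

/-- `P'` splits (P' - P)Y into orthogonal pieces that see only (1 - P)Y and PY respectively. Equal
ranks give both pieces the same factor, and Pythagoras on each side avoids the loss of the triangle
inequality. -/
theorem norm_sub_mul_le (h : IsOrthProj P) (h' : IsOrthProj P') (ht : P.trace = P'.trace)
    (Y : Matrix (Fin n) (Fin k) ℝ) : ‖(P' - P) * Y‖ ≤ ‖(1 - P') * P‖ * ‖Y‖ := by
  have e := h'.norm_sq_add_norm_sq ((P' - P) * Y)
  have e1 : P' * ((P' - P) * Y) = (P' * (1 - P)) * ((1 - P) * Y) := by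
    rw [← Matrix.mul_assoc, ← Matrix.mul_assoc (P' * (1 - P)), Matrix.mul_assoc P' (1 - P),
      h.one_sub.idem, mul_sub, mul_sub, h'.idem, mul_one]
  have e2 : (1 - P') * ((P' - P) * Y) = -(((1 - P') * P) * (P * Y)) := by
    rw [← Matrix.mul_assoc, ← Matrix.mul_assoc ((1 - P') * P), Matrix.mul_assoc (1 - P') P,
      h.idem, mul_sub, h'.one_sub_mul, zero_sub, Matrix.neg_mul]
  have b1 := Matrix.frobenius_norm_mul (P' * (1 - P)) ((1 - P) * Y)
  have b2 := Matrix.frobenius_norm_mul ((1 - P') * P) (P * Y)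
  rw [h'.norm_mul_one_sub h, ← h.norm_one_sub_mul_comm h' ht] at b1
  rw [e1, e2, norm_neg] at e
  have e3 := h.norm_sq_add_norm_sq Y
  refine le_of_sq_le_sq ?_ (by positivity)
  rw [← e, mul_pow, ← e3]
  have c1 := pow_le_pow_left₀ (norm_nonneg _) b1 2
  have c2 := pow_le_pow_left₀ (norm_nonneg _) b2 2
  rw [mul_pow] at c1 c2
  linarith

end IsOrthProj

theorem trace_eq_rank_of_mul_self {P : Matrix (Fin n) (Fin n) ℝ} (h : P * P = P) :
    P.trace = P.rank := by
  have hp : LinearMap.IsProj (LinearMap.range (Matrix.toLin' P)) (Matrix.toLin' P) := by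
    refine ⟨fun x => LinearMap.mem_range_self _ x, ?_⟩
    rintro _ ⟨y, rfl⟩
    rw [← LinearMap.comp_apply, ← Matrix.toLin'_mul, h]
  have := hp.trace
  rw [Matrix.trace_toLin'_eq] at this
  rw [this, Matrix.rank_eq_finrank_range_toLin P (Pi.basisFun ℝ _) (Pi.basisFun ℝ _),
    Matrix.toLin_eq_toLin']

/-- `H` is the Moore–Penrose inverse of `B`, with operator norm at most `c`. -/
structure PInv (B : Matrix (Fin l) (Fin m) ℝ) (H : Matrix (Fin m) (Fin l) ℝ) (c : ℝ) : Prop where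
  mul_mul_self : B * H * B = B
  mul_mul_inv : H * B * H = H
  symm_left : (B * H)ᵀ = B * H
  symm_right : (H * B)ᵀ = H * B
  bound : OpBound c H

namespace PInv

variable {B B' : Matrix (Fin l) (Fin m) ℝ} {H H' : Matrix (Fin m) (Fin l) ℝ} {c c' : ℝ}

theorem transpose (h : PInv B H c) : PInv Bᵀ Hᵀ c where
  mul_mul_self := by
    rw [← Matrix.transpose_mul, ← Matrix.transpose_mul, ← Matrix.mul_assoc, h.mul_mul_self]
  mul_mul_inv := by
    rw [← Matrix.transpose_mul, ← Matrix.transpose_mul, ← Matrix.mul_assoc, h.mul_mul_inv]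
  symm_left := by rw [← Matrix.transpose_mul, h.symm_right]; exact h.symm_right
  symm_right := by rw [← Matrix.transpose_mul, h.symm_left]; exact h.symm_left
  bound := h.bound.transpose

theorem left (h : PInv B H c) : IsOrthProj (B * H) where
  idem := by rw [← Matrix.mul_assoc, h.mul_mul_self]
  symm := h.symm_left

theorem right (h : PInv B H c) : IsOrthProj (H * B) where
  idem := by rw [← Matrix.mul_assoc, h.mul_mul_inv]
  symm := h.symm_right

theorem transpose_mul_transpose_left (h : PInv B H c) : Bᵀ * Hᵀ = H * B := by
  rw [← Matrix.transpose_mul, h.symm_right]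

theorem transpose_mul_transpose_right (h : PInv B H c) : Hᵀ * Bᵀ = B * H := by
  rw [← Matrix.transpose_mul, h.symm_left]

theorem trace_left (h : PInv B H c) : (B * H).trace = B.rank := by
  rw [trace_eq_rank_of_mul_self h.left.idem]
  congr 1
  refine le_antisymm (Matrix.rank_mul_le_left _ _) ?_
  conv_lhs => rw [← h.mul_mul_self]
  exact Matrix.rank_mul_le_left _ _

theorem one_sub_left_mul (h : PInv B H c) : (1 - B * H) * B = 0 := by
  rw [Matrix.sub_mul, h.mul_mul_self, Matrix.one_mul, sub_self]

theorem mul_one_sub_right (h : PInv B H c) : B * (1 - H * B) = 0 := by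
  rw [Matrix.mul_sub, ← Matrix.mul_assoc, h.mul_mul_self, Matrix.mul_one, sub_self]

/-- 1 - B'H' kills B', so B may be replaced by B - B'. -/
theorem norm_one_sub_mul_le (h : PInv B H c) (h' : PInv B' H' c') :
    ‖(1 - B' * H') * (B * H)‖ ≤ c * ‖B - B'‖ := by
  have e : (1 - B' * H') * (B * H) = ((1 - B' * H') * (B - B')) * H := by
    rw [Matrix.mul_sub, h'.one_sub_left_mul, sub_zero, Matrix.mul_assoc]
  rw [e]
  refine (h.bound.norm_mul_right_le _).trans ?_
  exact mul_le_mul_of_nonneg_left (h'.left.one_sub.norm_mul_le _) h.bound.1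

/-- Equal ranks allow the roles to be exchanged while keeping the constant `c` of `B`. This is why
only the singular values of the full solution, and not those of the DO solution, enter the growth
rate. -/
theorem norm_one_sub_mul_le' (h : PInv B H c) (h' : PInv B' H' c') (hr : B.rank = B'.rank) :
    ‖(1 - B * H) * (B' * H')‖ ≤ c * ‖B - B'‖ := by
  rw [← h.left.norm_one_sub_mul_comm h'.left (by rw [h.trace_left, h'.trace_left, hr])]
  exact h.norm_one_sub_mul_le h'

theorem norm_sub_mul_le (h : PInv B H c) (h' : PInv B' H' c') (hr : B.rank = B'.rank)
    (Y : Matrix (Fin l) (Fin k) ℝ) : ‖(B' * H' - B * H) * Y‖ ≤ c * ‖B - B'‖ * ‖Y‖ := by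
  refine (h.left.norm_sub_mul_le h'.left (by rw [h.trace_left, h'.trace_left, hr]) Y).trans ?_
  exact mul_le_mul_of_nonneg_right (h.norm_one_sub_mul_le h') (norm_nonneg _)

theorem norm_mul_sub_le (h : PInv B H c) (h' : PInv B' H' c') (hr : B.rank = B'.rank)
    (Y : Matrix (Fin k) (Fin m) ℝ) : ‖Y * (H' * B' - H * B)‖ ≤ c * ‖B - B'‖ * ‖Y‖ := by
  have := h.transpose.norm_sub_mul_le h'.transpose
    (by rw [Matrix.rank_transpose, Matrix.rank_transpose, hr]) Yᵀ
  rw [h.transpose_mul_transpose_left, h'.transpose_mul_transpose_left, ← Matrix.transpose_sub,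
    Matrix.frobenius_norm_transpose, Matrix.frobenius_norm_transpose] at this
  rwa [← Matrix.frobenius_norm_transpose, Matrix.transpose_mul, Matrix.transpose_sub,
    h.symm_right, h'.symm_right]

/-- The projections on the normal spaces at two matrices of the same rank are close to each
other. -/
theorem norm_normal_sub_le (h : PInv B H c) (h' : PInv B' H' c') (hr : B.rank = B'.rank)
    (X : Matrix (Fin l) (Fin m) ℝ) :
    ‖(1 - B * H) * X * (1 - H * B) - (1 - B' * H') * X * (1 - H' * B')‖ ≤
      2 * c * ‖B - B'‖ * ‖X‖ := by
  -- Change the left projection, then the right one; each change costs c‖B - B'‖, hence the factor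
  -- 2.
  have e : (1 - B * H) * X * (1 - H * B) - (1 - B' * H') * X * (1 - H' * B') =
      (B' * H' - B * H) * (X * (1 - H * B)) + ((1 - B' * H') * X) * (H' * B' - H * B) := by
    generalize B * H = P
    generalize B' * H' = P'
    generalize H * B = Q
    generalize H' * B' = Q'
    simp only [Matrix.sub_mul, Matrix.mul_sub, Matrix.one_mul, Matrix.mul_one, Matrix.mul_assoc]
    abel
  have hc := mul_nonneg h.bound.1 (norm_nonneg (B - B'))
  have b1 := (h.norm_sub_mul_le h' hr (X * (1 - H * B))).trans
    (mul_le_mul_of_nonneg_left (h.right.one_sub.norm_mul_right_le X) hc)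
  have b2 := (h.norm_mul_sub_le h' hr ((1 - B' * H') * X)).trans
    (mul_le_mul_of_nonneg_left (h'.left.one_sub.norm_mul_le X) hc)
  rw [e]
  linarith [norm_add_le ((B' * H' - B * H) * (X * (1 - H * B)))
    (((1 - B' * H') * X) * (H' * B' - H * B))]

end PInv

end Frobenius

end LowRank

end

noncomputable section

namespace LowRank

attribute [local instance] frobeniusInnerProductSpace

/-! ### Singular values, truncation and Weyl's inequality. -/

section Spectral

variable {k l m n : ℕ}

theorem sigma_nonneg (k : ℕ) (A : Matrix (Fin l) (Fin m) ℝ) : 0 ≤ sigma k A :=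
  LinearMap.singularValues_nonneg _ _

theorem sigma_pos_iff {k : ℕ} (hk : 1 ≤ k) (A : Matrix (Fin l) (Fin m) ℝ) :
    0 < sigma k A ↔ k ≤ A.rank := by
  rw [sigma, LinearMap.singularValues_pos_iff_lt_finrank_range,
    A.rank_eq_finrank_range_toLin (EuclideanSpace.basisFun _ ℝ).toBasis
      (EuclideanSpace.basisFun _ ℝ).toBasis, ← Matrix.toEuclideanLin_eq_toLin_orthonormal]
  -- `k - 1 < rank` and `k ≤ rank` are equivalent only because `k ≥ 1`.
  omega

theorem sigma_antitone {j k : ℕ} (hjk : j ≤ k) (A : Matrix (Fin l) (Fin m) ℝ) :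
    sigma k A ≤ sigma j A :=
  LinearMap.singularValues_antitone _ (Nat.sub_le_sub_right hjk 1)

theorem sigma_eq_zero_of_lt {k : ℕ} (hk : m < k) (A : Matrix (Fin l) (Fin m) ℝ) :
    sigma k A = 0 := by
  apply LinearMap.singularValues_of_finrank_le
  rw [finrank_euclideanSpace_fin]
  omega

/-- Spectral decomposition of the Gram matrix in terms of the singular values. -/
theorem exists_gram_eq (A : Matrix (Fin l) (Fin m) ℝ) :
    ∃ V : Matrix (Fin m) (Fin m) ℝ, Vᵀ * V = 1 ∧ V * Vᵀ = 1 ∧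
      Aᵀ * A = V * Matrix.diagonal (fun i : Fin m => sigma (i + 1) A ^ 2) * Vᵀ := by
  set f := Matrix.toEuclideanLin A
  have hf := f.isSymmetric_adjoint_comp_self
  have hn : Module.finrank ℝ (EuclideanSpace ℝ (Fin m)) = m := finrank_euclideanSpace_fin
  set b := hf.eigenvectorBasis hn
  let V : Matrix (Fin m) (Fin m) ℝ := Matrix.of fun i j => b j i
  have hVV : Vᵀ * V = 1 := by
    ext i j
    have := orthonormal_iff_ite.1 b.orthonormal i j
    rw [Matrix.one_apply, ← this]
    simp [V, Matrix.mul_apply, PiLp.inner_apply, mul_comm]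
  have hVV' : V * Vᵀ = 1 := mul_eq_one_comm.1 hVV
  refine ⟨V, hVV, hVV', ?_⟩
  have key : Aᵀ * A * V = V * Matrix.diagonal (fun i : Fin m => sigma (i + 1) A ^ 2) := by
    ext i j
    have h1 := hf.apply_eigenvectorBasis hn j
    rw [← f.sq_singularValues_fin hn j] at h1
    have h2 : (f.adjoint ∘ₗ f) (b j) = Matrix.toEuclideanLin (Aᵀ * A) (b j) := by
      rw [LinearMap.comp_apply, ← Matrix.toEuclideanLin_conjTranspose_eq_adjoint,
        Matrix.conjTranspose_eq_transpose_of_trivial]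
      simp [f, Matrix.toLpLin_apply]
    have h3 := congrArg (fun v : EuclideanSpace ℝ (Fin m) => v i) (h2.symm.trans h1)
    rw [Matrix.mul_diagonal]
    simpa [V, Matrix.mul_apply, Matrix.mulVec, dotProduct, Matrix.toLpLin_apply, sigma, mul_comm]
      using h3
  rw [← key, Matrix.mul_assoc, hVV', Matrix.mul_one]

/-- Norms of products AY depend on A only through AᵀA, so left singular vectors are never needed. -/
theorem norm_sq_mul_of_gram_eq {A : Matrix (Fin l) (Fin m) ℝ} {V : Matrix (Fin m) (Fin m) ℝ}
    {d : Fin m → ℝ} (h : Aᵀ * A = V * Matrix.diagonal d * Vᵀ) (Y : Matrix (Fin m) (Fin k) ℝ) :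
    ‖A * Y‖ ^ 2 = ∑ j, ∑ i, d i * (Vᵀ * Y) i j ^ 2 := by
  have e : (A * Y)ᵀ * (A * Y) = (Vᵀ * Y)ᵀ * (Matrix.diagonal d * (Vᵀ * Y)) := by
    rw [Matrix.transpose_mul, Matrix.mul_assoc, ← Matrix.mul_assoc Aᵀ, h]
    simp only [Matrix.transpose_mul, Matrix.transpose_transpose, Matrix.mul_assoc]
  rw [norm_sq_eq_trace, e, Matrix.trace]
  refine Finset.sum_congr rfl fun j _ => ?_
  rw [Matrix.diag_apply, Matrix.mul_apply]
  refine Finset.sum_congr rfl fun i _ => ?_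
  rw [Matrix.diagonal_mul, Matrix.transpose_apply]
  ring

theorem norm_sq_eq_of_orthogonal {V : Matrix (Fin m) (Fin m) ℝ} (hV : V * Vᵀ = 1)
    (Y : Matrix (Fin m) (Fin k) ℝ) : ‖Y‖ ^ 2 = ∑ j, ∑ i, (Vᵀ * Y) i j ^ 2 := by
  have := norm_sq_mul_of_gram_eq (A := (1 : Matrix (Fin m) (Fin m) ℝ)) (V := V) (d := fun _ => 1)
    (by simp [hV]) Y
  simpa using this

theorem opBound_of_gram_eq {A : Matrix (Fin l) (Fin m) ℝ} {V : Matrix (Fin m) (Fin m) ℝ}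
    {d : Fin m → ℝ} (hV : V * Vᵀ = 1) (h : Aᵀ * A = V * Matrix.diagonal d * Vᵀ) {c : ℝ}
    (hc : 0 ≤ c) (hd : ∀ i, d i ≤ c ^ 2) : OpBound c A := by
  refine ⟨hc, fun k Y => le_of_sq_le_sq ?_ (by positivity)⟩
  rw [mul_pow, norm_sq_mul_of_gram_eq h, norm_sq_eq_of_orthogonal hV, Finset.mul_sum]
  refine Finset.sum_le_sum fun j _ => ?_
  rw [Finset.mul_sum]
  exact Finset.sum_le_sum fun i _ => mul_le_mul_of_nonneg_right (hd i) (sq_nonneg _)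

/-- `A = R + N` is the truncation of the singular value decomposition of `A` after the `r`-th
singular value, and `H` is the Moore–Penrose inverse of `R`. -/
structure IsTruncation (r : ℕ) (A R N : Matrix (Fin l) (Fin m) ℝ) (H : Matrix (Fin m) (Fin l) ℝ) :
    Prop where
  eq_add : A = R + N
  pinv : PInv R H (sigma r A)⁻¹
  bound : OpBound (sigma (r + 1) A) N
  transpose_mul : Rᵀ * N = 0
  mul_transpose : R * Nᵀ = 0
  rank_eq : R.rank = r

/-- Matrices diagonalized by `V` multiply like functions on the indices. With `e` the indicator of
the first `r` indices and `p` the inverse of `d` there, the truncation is R = A S(e), N = A S(1 -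
e), H = S(p) Aᵀ, and each property becomes an identity or inequality between diagonal entries. -/
theorem exists_isTruncation {r : ℕ} {A : Matrix (Fin l) (Fin m) ℝ}
    (hA : 0 < sigma r A) : ∃ R N H, IsTruncation r A R N H := by
  obtain ⟨V, hV, hV', hG⟩ := exists_gram_eq A
  set d : Fin m → ℝ := fun i => sigma (i + 1) A ^ 2 with hd
  let e : Fin m → ℝ := fun i => if (i : ℕ) < r then 1 else 0
  let p : Fin m → ℝ := fun i => if (i : ℕ) < r then (d i)⁻¹ else 0
  have hsig : ∀ i : Fin m, (i : ℕ) < r → sigma r A ≤ sigma (i + 1) A := fun i hi =>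
    sigma_antitone (by omega) A
  have hdpos : ∀ i : Fin m, (i : ℕ) < r → 0 < d i := fun i hi =>
    pow_pos (hA.trans_le (hsig i hi)) 2
  have ee : ∀ i, e i * e i = e i := fun i => by simp [e]
  have pd : ∀ i, p i * d i = e i := fun i => by
    by_cases hi : (i : ℕ) < r
    · simp [p, e, hi, (hdpos i hi).ne']
    · simp [p, e, hi]
  have pe : ∀ i, p i * e i = p i := fun i => by
    by_cases hi : (i : ℕ) < r <;> simp [p, e, hi]
  have hep : (fun i => e i * p i) = p := funext fun i => by rw [mul_comm, pe]
  have hee : (fun i => e i * e i) = e := funext ee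
  -- the algebra of the matrices diagonalized by `V`
  obtain ⟨S, hS⟩ : ∃ S : (Fin m → ℝ) → Matrix (Fin m) (Fin m) ℝ,
      ∀ x, S x = V * Matrix.diagonal x * Vᵀ := ⟨_, fun _ => rfl⟩
  have S_mul : ∀ x y, S x * S y = S (fun i => x i * y i) := fun x y => by
    simp only [hS]
    rw [Matrix.mul_assoc, Matrix.mul_assoc V _ Vᵀ, ← Matrix.mul_assoc Vᵀ, hV, Matrix.one_mul,
      ← Matrix.mul_assoc, Matrix.mul_assoc V, ← Matrix.mul_assoc, ← Matrix.diagonal_mul_diagonal,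
      Matrix.mul_assoc V]
  have S_symm : ∀ x, (S x)ᵀ = S x := fun x => by
    simp [hS, Matrix.transpose_mul, Matrix.mul_assoc]
  have S_trace : ∀ x, (S x).trace = ∑ i, x i := fun x => by
    simp only [hS]
    rw [Matrix.trace_mul_comm, ← Matrix.mul_assoc, hV, Matrix.one_mul, Matrix.trace_diagonal]
  have S_sub : ∀ x, 1 - S x = S (fun i => 1 - x i) := fun x => by
    have h1 : S (fun _ => 1) = 1 := by simp [hS, hV']
    have h2 : Matrix.diagonal (fun i => 1 - x i) =
        Matrix.diagonal (fun _ => (1 : ℝ)) - Matrix.diagonal x := by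
      rw [Matrix.diagonal_sub]
    rw [← h1]
    simp only [hS]
    rw [h2, Matrix.mul_sub, Matrix.sub_mul]
  have hG' : Aᵀ * A = S d := hG.trans (hS d).symm
  have hR : ∀ x y, (A * S x)ᵀ * (A * S y) = S (fun i => x i * (d i * y i)) := fun x y => by
    rw [Matrix.transpose_mul, S_symm, Matrix.mul_assoc, ← Matrix.mul_assoc Aᵀ, hG', S_mul, S_mul]
  have hHt : (S p * Aᵀ)ᵀ = A * S p := by
    rw [Matrix.transpose_mul, Matrix.transpose_transpose, S_symm]
  have hpR : (S p * Aᵀ) * (A * S e) = S e := by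
    have := hR p e
    rw [← hHt, Matrix.transpose_transpose] at this
    rw [this]
    congr 1; ext i
    rw [← mul_assoc, pd, ee]
  have hRp : (A * S e) * (S p * Aᵀ) = A * S p * Aᵀ := by
    rw [Matrix.mul_assoc, ← Matrix.mul_assoc (S e), S_mul, hep, Matrix.mul_assoc]
  have hpinv : PInv (A * S e) (S p * Aᵀ) (sigma r A)⁻¹ := by
    refine ⟨?_, ?_, ?_, ?_, ?_⟩
    · rw [Matrix.mul_assoc, hpR, Matrix.mul_assoc, S_mul, hee]
    · rw [hpR, ← Matrix.mul_assoc, S_mul, hep]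
    · rw [hRp, Matrix.transpose_mul, Matrix.transpose_mul, S_symm, Matrix.transpose_transpose,
        Matrix.mul_assoc]
    · rw [hpR, S_symm]
    · have : OpBound (sigma r A)⁻¹ (A * S p) := by
        refine opBound_of_gram_eq hV' ((hR p p).trans (hS _)) (inv_nonneg.2 hA.le) fun i => ?_
        rw [mul_comm (d i), pd, pe]
        by_cases hi : (i : ℕ) < r
        · simp only [p, hi, if_true, hd, ← inv_pow]
          exact pow_le_pow_left₀ (inv_nonneg.2 (hA.trans_le (hsig i hi)).le)
            (inv_anti₀ hA (hsig i hi)) 2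
        · simp only [p, hi, if_false]; positivity
      have := this.transpose
      rwa [← hHt, Matrix.transpose_transpose] at this
  -- Needed for the rank: the indicator `e` sums to `r` only if there are at least `r` columns.
  have hrm : r ≤ m := by
    by_contra h
    exact hA.ne' (sigma_eq_zero_of_lt (not_le.1 h) A)
  refine ⟨A * S e, A * S (fun i => 1 - e i), S p * Aᵀ, ?_, hpinv, ?_, ?_, ?_, ?_⟩
  · rw [← S_sub, Matrix.mul_sub, Matrix.mul_one, add_sub_cancel]
  · refine opBound_of_gram_eq hV' ((hR _ _).trans (hS _)) (sigma_nonneg _ _) fun i => ?_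
    by_cases hi : (i : ℕ) < r
    · simp only [e, hi, if_true]; simp [sq_nonneg]
    · simp only [e, hi, if_false, hd]
      simpa using pow_le_pow_left₀ (sigma_nonneg _ _) (sigma_antitone (by omega) A) 2
  · rw [hR]
    have : (fun i => e i * (d i * (1 - e i))) = fun _ => 0 := by
      ext i
      have := ee i
      linear_combination (-(d i)) * this
    rw [this]; simp [hS]
  · rw [Matrix.transpose_mul, S_symm, Matrix.mul_assoc, ← Matrix.mul_assoc (S e), S_mul]
    have : (fun i => e i * (1 - e i)) = fun _ => 0 := by
      ext i
      have := ee i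
      linear_combination -this
    rw [this]; simp [hS]
  · have h1 := hpinv.trace_left
    rw [Matrix.trace_mul_comm, hpR, S_trace] at h1
    have h2 : ∑ i, e i = r := by
      simp only [e, Finset.sum_boole]
      rw [Fin.card_filter_val_lt]
      simp [hrm]
    exact_mod_cast h1.symm.trans h2

/-- A matrix of rank `r` is its own truncation. -/
theorem exists_pinv {r : ℕ} (hr : 1 ≤ r) {B : Matrix (Fin l) (Fin m) ℝ} (hB : B.rank = r) :
    ∃ H, PInv B H (sigma r B)⁻¹ := by
  obtain ⟨R, N, H, h⟩ := exists_isTruncation ((sigma_pos_iff hr B).2 hB.ge)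
  have h0 : sigma (r + 1) B = 0 := by
    refine le_antisymm ?_ (sigma_nonneg _ _)
    by_contra hc
    have := (sigma_pos_iff (by omega) B).1 (not_le.1 hc)
    omega
  have hN : N = 0 := by
    have := h.bound.2 m 1
    rw [h0, zero_mul, Matrix.mul_one] at this
    exact norm_le_zero_iff.1 this
  have hBR : B = R := by rw [h.eq_add, hN, add_zero]
  have h2 := h.pinv
  rw [← hBR] at h2
  exact ⟨H, h2⟩

/-- Weyl's inequality. -/
theorem sigma_le_add_norm_sub {k : ℕ} (hk : 1 ≤ k) (A B : Matrix (Fin l) (Fin m) ℝ) :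
    sigma k A ≤ sigma k B + ‖A - B‖ := by
  rcases lt_or_ge m k with hm | hm
  · rw [sigma_eq_zero_of_lt hm, sigma_eq_zero_of_lt hm]
    positivity
  obtain ⟨V, hV, hV', hG⟩ := exists_gram_eq A
  obtain ⟨U, hU, hU', hG'⟩ := exists_gram_eq B
  let i₀ : Fin m := ⟨k - 1, by omega⟩
  -- a vector in the top `k` right singular space of `A` and in the bottom one of `B`
  let f : (Fin m → ℝ) →ₗ[ℝ] (Fin m → ℝ) := LinearMap.pi fun i =>
    if i < i₀ then LinearMap.proj i ∘ₗ Matrix.toLin' Uᵀ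
    else if i₀ < i then LinearMap.proj i ∘ₗ Matrix.toLin' Vᵀ else 0
  -- The coordinate `i₀` of `f` is identically zero, so `f` imposes at most m - 1 conditions and
  -- cannot be surjective.
  have hf : ¬ Function.Injective f := by
    rw [LinearMap.injective_iff_surjective]
    intro hs
    obtain ⟨v, hv⟩ := hs (Pi.single i₀ 1)
    have := congrFun hv i₀
    simp [f] at this
  obtain ⟨v, hv, hv0⟩ : ∃ v, f v = 0 ∧ v ≠ 0 := by
    by_contra hc
    push Not at hc
    exact hf ((injective_iff_map_eq_zero f).2 hc)
  let Y : Matrix (Fin m) (Fin 1) ℝ := Matrix.of fun i _ => v i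
  have hY : 0 < ‖Y‖ := by
    rw [norm_pos_iff]
    intro h0
    exact hv0 (funext fun i => congrFun (congrFun h0 i) 0)
  have hYU : ∀ i < i₀, ∀ j, (Uᵀ * Y) i j = 0 := fun i hi j => by
    have := congrFun hv i
    simpa [f, hi, Matrix.mulVec, dotProduct, Matrix.mul_apply, Y] using this
  have hYV : ∀ i, i₀ < i → ∀ j, (Vᵀ * Y) i j = 0 := fun i hi j => by
    have := congrFun hv i
    simpa [f, hi, hi.le, not_lt.2 hi.le, Matrix.mulVec, dotProduct, Matrix.mul_apply, Y] using this
  have hA : sigma k A * ‖Y‖ ≤ ‖A * Y‖ := by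
    refine le_of_sq_le_sq ?_ (norm_nonneg _)
    rw [mul_pow, norm_sq_mul_of_gram_eq hG, norm_sq_eq_of_orthogonal hV', Finset.mul_sum]
    refine Finset.sum_le_sum fun j _ => ?_
    rw [Finset.mul_sum]
    refine Finset.sum_le_sum fun i _ => ?_
    rcases lt_or_ge i₀ i with hi | hi
    · simp [hYV i hi]
    · have : (i : ℕ) ≤ k - 1 := hi
      exact mul_le_mul_of_nonneg_right
        (pow_le_pow_left₀ (sigma_nonneg _ _) (sigma_antitone (by omega) A) 2) (sq_nonneg _)
  have hB : ‖B * Y‖ ≤ sigma k B * ‖Y‖ := by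
    refine le_of_sq_le_sq ?_ (mul_nonneg (sigma_nonneg _ _) (norm_nonneg _))
    rw [mul_pow, norm_sq_mul_of_gram_eq hG', norm_sq_eq_of_orthogonal hU', Finset.mul_sum]
    refine Finset.sum_le_sum fun j _ => ?_
    rw [Finset.mul_sum]
    refine Finset.sum_le_sum fun i _ => ?_
    rcases lt_or_ge i i₀ with hi | hi
    · simp [hYU i hi]
    · have : k - 1 ≤ (i : ℕ) := hi
      exact mul_le_mul_of_nonneg_right
        (pow_le_pow_left₀ (sigma_nonneg _ _) (sigma_antitone (by omega) B) 2) (sq_nonneg _)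
  have hAB := Matrix.frobenius_norm_mul (A - B) Y
  have htri : ‖A * Y‖ ≤ ‖B * Y‖ + ‖(A - B) * Y‖ := by
    refine (congrArg norm ?_).le.trans (norm_add_le _ _)
    rw [← Matrix.add_mul, add_sub_cancel]
  refine le_of_mul_le_mul_right ?_ hY
  linarith

theorem continuous_sigma {k : ℕ} (hk : 1 ≤ k) :
    Continuous (sigma k : Matrix (Fin l) (Fin m) ℝ → ℝ) := by
  refine (LipschitzWith.of_le_add_mul (1 : NNReal) fun A B => ?_).continuous
  simpa [dist_eq_norm] using sigma_le_add_norm_sub hk A B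

end Spectral

end LowRank

end

noncomputable section

namespace LowRank

attribute [local instance] frobeniusInnerProductSpace

/-! ### The tangent space and its orthogonal projection. -/

section Tangent

variable {l m r : ℕ} {B : Matrix (Fin l) (Fin m) ℝ} {H : Matrix (Fin m) (Fin l) ℝ} {c : ℝ}

/-- Left and right multiplication, as a continuous linear map. -/
def mulMulCLM (M : Matrix (Fin l) (Fin l) ℝ) (N : Matrix (Fin m) (Fin m) ℝ) :
    Matrix (Fin l) (Fin m) ℝ →L[ℝ] Matrix (Fin l) (Fin m) ℝ :=
  LinearMap.toContinuousLinearMap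
    { toFun := fun Y => M * Y * N
      map_add' := fun Y Z => by rw [Matrix.mul_add, Matrix.add_mul]
      map_smul' := fun a Y => by simp }

/-- The normal component of a matrix of rank `r` near `B` is of second order. -/
theorem PInv.norm_normal_le (h : PInv B H c) {B' : Matrix (Fin l) (Fin m) ℝ}
    {H' : Matrix (Fin m) (Fin l) ℝ} {c' : ℝ} (h' : PInv B' H' c') (hr : B.rank = B'.rank) :
    ‖(1 - B * H) * (B' - B) * (1 - H * B)‖ ≤ c * ‖B' - B‖ ^ 2 := by
  -- B vanishes against 1 - HB, and B' = B'H'B' inserts the factor (1 - BH)B'H', which is itself of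
  -- first order.
  have e : (1 - B * H) * (B' - B) * (1 - H * B) =
      ((1 - B * H) * (B' * H')) * ((B' - B) * (1 - H * B)) := by
    have e1 : (B' - B) * (1 - H * B) = B' * (1 - H * B) := by
      rw [Matrix.sub_mul, h.mul_one_sub_right, sub_zero]
    rw [Matrix.mul_assoc, e1, Matrix.mul_assoc, ← Matrix.mul_assoc (B' * H'), h'.mul_mul_self]
  rw [e]
  refine (Matrix.frobenius_norm_mul _ _).trans ?_
  have h1 := h.norm_one_sub_mul_le' h' hr
  have h2 := h.right.one_sub.norm_mul_right_le (B' - B)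
  rw [norm_sub_rev] at h1
  have h3 := mul_nonneg h.bound.1 (norm_nonneg (B' - B))
  calc _ ≤ (c * ‖B' - B‖) * ‖B' - B‖ := by gcongr
    _ = _ := by ring

/-- Along a curve of constant rank the normal component of γ(t) - B is O(t²), so its derivative at 0
vanishes. -/
theorem normal_eq_zero_of_mem_velocities (hr : 1 ≤ r) (h : PInv B H c)
    (hB : B.rank = r) {X : Matrix (Fin l) (Fin m) ℝ} (hX : X ∈ velocities r B) :
    (1 - B * H) * X * (1 - H * B) = 0 := by
  obtain ⟨γ, -, hrank, h0, hd⟩ := hX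
  set f := mulMulCLM (1 - B * H) (1 - H * B)
  have h1 : HasDerivAt (fun t => f (γ t)) (f X) 0 := f.hasFDerivAt.comp_hasDerivAt 0 hd
  have hO : (fun t => γ t - B) =O[𝓝 0] fun t : ℝ => t := by
    have := hd.isBigO_sub
    simpa [h0] using this
  have h2 : HasDerivAt (fun t => f (γ t)) 0 0 := by
    refine hasDerivAt_iff_isLittleO.2 ?_
    have hb : (fun t => f (γ t) - f (γ 0) - (t - 0) • (0 : Matrix (Fin l) (Fin m) ℝ)) =O[𝓝 0]
        fun t => ‖γ t - B‖ ^ 2 := by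
      refine Asymptotics.IsBigO.of_bound c ?_
      filter_upwards [hrank] with t ht
      obtain ⟨H', h'⟩ := exists_pinv hr ht
      have := h.norm_normal_le h' (hB.trans ht.symm)
      rw [h0, smul_zero, sub_zero, ← map_sub, norm_pow, norm_norm]
      exact this
    refine hb.trans_isLittleO ((hO.norm_left.pow 2).trans_isLittleO ?_)
    simpa using (Asymptotics.isLittleO_pow_id (𝕜 := ℝ) (n := 2) (by norm_num))
  exact h1.unique h2

/-- The curve (1 + tZ₁)B(1 + tZ₂) keeps the rank while both outer factors are invertible, and its
velocity is Z₁B + BZ₂. -/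
theorem mem_velocities_of_normal_eq_zero (hB : B.rank = r)
    {Y : Matrix (Fin l) (Fin m) ℝ} (hY : (1 - B * H) * Y * (1 - H * B) = 0) :
    Y ∈ velocities r B := by
  -- Z₁B = Y(HB) is one part of Y; BZ₂ = (BH)Y(1 - HB) is the rest, because the normal component of
  -- Y is zero.
  set Z₁ := Y * H
  set Z₂ := H * Y * (1 - H * B)
  have hZ : Z₁ * B + B * Z₂ = Y := by
    have e : B * Z₂ = B * H * Y * (1 - H * B) := by simp only [Z₂, Matrix.mul_assoc]
    rw [Matrix.sub_mul, Matrix.sub_mul, sub_eq_zero] at hY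
    rw [e, ← hY, Matrix.one_mul, Matrix.mul_sub, Matrix.mul_one, Matrix.mul_assoc,
      add_sub_cancel]
  have hpoly : (fun t : ℝ => (1 + t • Z₁) * B * (1 + t • Z₂)) =
      fun t => B + t • Y + t ^ 2 • (Z₁ * B * Z₂) := by
    funext t
    rw [← hZ]
    simp only [Matrix.add_mul, Matrix.mul_add, Matrix.one_mul, Matrix.mul_one, Matrix.smul_mul,
      Matrix.mul_smul, smul_add, smul_smul, pow_two, Matrix.mul_assoc]
    abel
  have hunit : ∀ {n : ℕ} (Z : Matrix (Fin n) (Fin n) ℝ),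
      ∀ᶠ t : ℝ in 𝓝 0, IsUnit (1 + t • Z).det := fun {n} Z => by
    have hc : Continuous fun t : ℝ => (1 + t • Z).det := by fun_prop
    have : ∀ᶠ t : ℝ in 𝓝 0, (1 + t • Z).det ≠ 0 :=
      hc.continuousAt.eventually_ne (by simp)
    exact this.mono fun t ht => isUnit_iff_ne_zero.2 ht
  refine ⟨fun t : ℝ => (1 + t • Z₁) * B * (1 + t • Z₂), ?_, ?_, by simp, ?_⟩
  · rw [hpoly]
    fun_prop
  · filter_upwards [hunit Z₁, hunit Z₂] with t h1 h2
    rw [Matrix.rank_mul_eq_left_of_isUnit_det _ _ h2, Matrix.rank_mul_eq_right_of_isUnit_det _ _ h1,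
      hB]
  · rw [hpoly]
    have h1 : HasDerivAt (fun t : ℝ => B + t • Y + t ^ 2 • (Z₁ * B * Z₂))
        ((1 : ℝ) • Y + ((2 : ℕ) * (0 : ℝ) ^ (2 - 1)) • (Z₁ * B * Z₂)) 0 :=
      (((hasDerivAt_id (0 : ℝ)).smul_const Y).const_add B).add
        ((hasDerivAt_pow 2 (0 : ℝ)).smul_const _)
    simpa using h1

theorem mem_tangentSpace_iff (hr : 1 ≤ r) (h : PInv B H c) (hB : B.rank = r)
    {Y : Matrix (Fin l) (Fin m) ℝ} :
    Y ∈ tangentSpace r B ↔ (1 - B * H) * Y * (1 - H * B) = 0 := by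
  refine ⟨fun hY => ?_, fun hY => Submodule.subset_span (mem_velocities_of_normal_eq_zero hB hY)⟩
  have : tangentSpace r B ≤ LinearMap.ker (mulMulCLM (1 - B * H) (1 - H * B)).toLinearMap :=
    Submodule.span_le.2 fun X hX => normal_eq_zero_of_mem_velocities hr h hB hX
  exact this hY

/-- X ↦ (1 - BH)X(1 - HB) is a self-adjoint idempotent whose kernel is the tangent space. -/
theorem projT_eq (hr : 1 ≤ r) (h : PInv B H c) (hB : B.rank = r) (X : Matrix (Fin l) (Fin m) ℝ) :
    projT r B X = X - (1 - B * H) * X * (1 - H * B) := by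
  have hP := h.left.one_sub
  have hQ := h.right.one_sub
  refine Submodule.eq_starProjection_of_mem_of_inner_eq_zero ?_ fun Y hY => ?_
  · rw [mem_tangentSpace_iff hr h hB]
    generalize 1 - B * H = P at hP ⊢
    generalize 1 - H * B = Q at hQ ⊢
    rw [Matrix.mul_sub, Matrix.sub_mul, sub_eq_zero, Matrix.mul_assoc P X, ← Matrix.mul_assoc P P,
      hP.idem, ← Matrix.mul_assoc, Matrix.mul_assoc (P * X), hQ.idem]
  · rw [mem_tangentSpace_iff hr h hB] at hY
    rw [sub_sub_cancel, real_inner_comm, inner_eq_trace, ← Matrix.mul_assoc, Matrix.trace_mul_comm,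
      ← Matrix.mul_assoc, ← hP.symm, ← hQ.symm, ← Matrix.mul_assoc, ← Matrix.transpose_mul,
      ← Matrix.transpose_mul, ← Matrix.mul_assoc, hY]
    simp

end Tangent

end LowRank

end

noncomputable section

namespace LowRank

attribute [local instance] frobeniusInnerProductSpace

/-! ### The nearest matrix of rank r: existence, uniqueness, continuity. -/

section Nearest

variable {l m r : ℕ} {A R N : Matrix (Fin l) (Fin m) ℝ} {H : Matrix (Fin m) (Fin l) ℝ}

namespace IsTruncation

theorem left_mul (h : IsTruncation r A R N H) : R * H * N = 0 := by
  rw [← h.pinv.transpose_mul_transpose_right, Matrix.mul_assoc, h.transpose_mul, Matrix.mul_zero]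

theorem mul_right (h : IsTruncation r A R N H) : N * (H * R) = 0 := by
  rw [← h.pinv.transpose_mul_transpose_left, ← Matrix.mul_assoc,
    ← Matrix.transpose_transpose (N * Rᵀ), Matrix.transpose_mul, Matrix.transpose_transpose,
    h.mul_transpose]
  simp

theorem left_mul_eq (h : IsTruncation r A R N H) : R * H * A = R := by
  rw [h.eq_add, Matrix.mul_add, h.pinv.mul_mul_self, h.left_mul, add_zero]

/-- A quantitative form of the Eckart–Young theorem. -/
theorem norm_sub_sq_le (h : IsTruncation r A R N H) (hA : 0 < sigma r A)
    {B : Matrix (Fin l) (Fin m) ℝ} {H' : Matrix (Fin m) (Fin l) ℝ} {c : ℝ} (h' : PInv B H' c)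
    (hB : B.rank = r) :
    ‖A - R‖ ^ 2 + (sigma r A ^ 2 - sigma (r + 1) A ^ 2) * ‖(1 - B * H') * (R * H)‖ ^ 2 +
      ‖B * H' * A - B‖ ^ 2 ≤ ‖A - B‖ ^ 2 := by
  have hP' := h'.left
  have hP := h.pinv.left
  have htr : (R * H).trace = (B * H').trace := by
    rw [h.pinv.trace_left, h'.trace_left, h.rank_eq, hB]
  have hPN : (1 - R * H) * N = N := by
    rw [Matrix.sub_mul, h.left_mul, Matrix.one_mul, sub_zero]
  have hPB := h'.one_sub_left_mul
  have hPB' := h'.mul_mul_self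
  have hRH : ‖(1 - B * H') * (R * H)‖ ≤ (sigma r A)⁻¹ * ‖(1 - B * H') * R‖ := by
    rw [← Matrix.mul_assoc]
    exact h.pinv.bound.norm_mul_right_le _
  generalize B * H' = P' at *
  generalize R * H = P at *
  have e0 : A - R = N := by rw [h.eq_add, add_sub_cancel_left]
  -- Pythagoras for P' gives ‖A - B‖² = ‖P'A - B‖² + ‖(1 - P')A‖². As RNᵀ = 0, the last term splits
  -- into ‖(1 - P')R‖², at least σ_r²δ², and ‖N‖² - ‖P'N‖², at least ‖N‖² - σ_{r+1}²δ², where δ =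
  -- ‖(1 - P')P‖.
  have e1 := hP'.norm_sq_add_norm_sq (A - B)
  rw [Matrix.mul_sub, Matrix.mul_sub, hPB, hPB', sub_zero] at e1
  have e2 : ‖(1 - P') * A‖ ^ 2 = ‖(1 - P') * R‖ ^ 2 + ‖(1 - P') * N‖ ^ 2 := by
    rw [h.eq_add, Matrix.mul_add, norm_add_sq_of_trace_eq_zero]
    rw [Matrix.transpose_mul, hP'.one_sub.symm, Matrix.mul_assoc, ← Matrix.mul_assoc (1 - P'),
      hP'.one_sub.idem, Matrix.trace_mul_comm, Matrix.mul_assoc, ← Matrix.transpose_transpose N,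
      ← Matrix.transpose_mul, h.mul_transpose]
    simp
  have e3 := hP'.norm_sq_add_norm_sq N
  have e4 : ‖P' * N‖ ≤ sigma (r + 1) A * ‖(1 - P') * P‖ := by
    have : P' * N = P' * (1 - P) * N := by rw [Matrix.mul_assoc, hPN]
    rw [this, hP.norm_one_sub_mul_comm hP' htr, ← hP'.norm_mul_one_sub hP]
    exact h.bound.norm_mul_right_le _
  have e5 : sigma r A * ‖(1 - P') * P‖ ≤ ‖(1 - P') * R‖ := by
    rwa [← div_eq_inv_mul, le_div_iff₀ hA, mul_comm] at hRH
  have e4' := pow_le_pow_left₀ (norm_nonneg _) e4 2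
  have e5' := pow_le_pow_left₀ (by positivity) e5 2
  rw [mul_pow] at e4' e5'
  rw [e0]
  linarith

theorem sigma_sq_sub_pos (hgap : sigma (r + 1) A < sigma r A) :
    0 < sigma r A ^ 2 - sigma (r + 1) A ^ 2 := by
  have := sigma_nonneg (r + 1) A
  nlinarith

theorem isNearest (h : IsTruncation r A R N H) (hr : 1 ≤ r)
    (hgap : sigma (r + 1) A < sigma r A) : IsNearest r A R := by
  refine ⟨h.rank_eq, fun B hB => ?_⟩
  obtain ⟨H', h'⟩ := exists_pinv hr hB
  have := h.norm_sub_sq_le ((sigma_nonneg _ _).trans_lt hgap) h' hB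
  have hp := sigma_sq_sub_pos hgap
  refine le_of_sq_le_sq (le_trans ?_ this) (norm_nonneg _)
  rw [add_assoc]
  exact le_add_of_nonneg_right (by positivity)

/-- Minimality makes both surplus terms of `norm_sub_sq_le` vanish: the column projections of B and
R coincide, and B is this projection applied to A, which is R. -/
theorem eq_of_isNearest (h : IsTruncation r A R N H) (hr : 1 ≤ r)
    (hgap : sigma (r + 1) A < sigma r A) {B : Matrix (Fin l) (Fin m) ℝ} (hB : IsNearest r A B) :
    B = R := by
  obtain ⟨H', h'⟩ := exists_pinv hr hB.1
  have h1 := h.norm_sub_sq_le ((sigma_nonneg _ _).trans_lt hgap) h' hB.1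
  have h2 := pow_le_pow_left₀ (norm_nonneg _) (hB.2 R h.rank_eq) 2
  have hp := sigma_sq_sub_pos hgap
  have h3 := mul_nonneg hp.le (sq_nonneg ‖(1 - B * H') * (R * H)‖)
  have h4 := sq_nonneg ‖B * H' * A - B‖
  have h5 : ‖(1 - B * H') * (R * H)‖ ^ 2 = 0 := by
    have : (sigma r A ^ 2 - sigma (r + 1) A ^ 2) * ‖(1 - B * H') * (R * H)‖ ^ 2 = 0 := by linarith
    exact (mul_eq_zero.1 this).resolve_left hp.ne'
  have h6 : ‖B * H' * A - B‖ ^ 2 = 0 := by linarith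
  have h7 : B * H' * A = B := by
    rw [← sub_eq_zero, ← norm_eq_zero]
    exact pow_eq_zero_iff (two_ne_zero) |>.1 h6
  have h8 := h.pinv.left.norm_sub_mul_le h'.left
    (by rw [h.pinv.trace_left, h'.trace_left, h.rank_eq, hB.1]) A
  rw [pow_eq_zero_iff two_ne_zero |>.1 h5, zero_mul, norm_le_zero_iff, Matrix.sub_mul, h7,
    h.left_mul_eq, sub_eq_zero] at h8
  exact h8

theorem projM_eq (h : IsTruncation r A R N H) (hr : 1 ≤ r)
    (hgap : sigma (r + 1) A < sigma r A) : projM r A = R := by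
  have hu : ∃! P, IsNearest r A P :=
    ⟨R, h.isNearest hr hgap, fun B hB => h.eq_of_isNearest hr hgap hB⟩
  rw [projM, dif_pos hu]
  exact h.eq_of_isNearest hr hgap hu.choose_spec.1

end IsTruncation

theorem exists_isTruncation_projM (hr : 1 ≤ r) (hgap : sigma (r + 1) A < sigma r A) :
    ∃ N H, IsTruncation r A (projM r A) N H := by
  obtain ⟨R, N, H, h⟩ := exists_isTruncation ((sigma_nonneg _ _).trans_lt hgap)
  exact ⟨N, H, by rwa [h.projM_eq hr hgap]⟩

/-- The set on which the projection on the matrices of rank `r` is well defined. -/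
def gapSet (r l m : ℕ) : Set (Matrix (Fin l) (Fin m) ℝ) :=
  {A | sigma (r + 1) A < sigma r A}

/-- The nearest point of A' is optimal for A up to 2‖A' - A‖, so the surplus in `norm_sub_sq_le` is
small. The square-root modulus is crude but yields continuity, from which differentiability is
bootstrapped. -/
theorem norm_projM_sub_le (hr : 1 ≤ r) (hgap : A ∈ gapSet r l m)
    {A' : Matrix (Fin l) (Fin m) ℝ} (hgap' : A' ∈ gapSet r l m) :
    ‖projM r A' - projM r A‖ ≤ ‖A' - A‖ + √(((‖A - projM r A‖ + 2 * ‖A' - A‖) ^ 2 -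
      ‖A - projM r A‖ ^ 2) / (sigma r A ^ 2 - sigma (r + 1) A ^ 2)) * ‖A‖ := by
  obtain ⟨N, H, h⟩ := exists_isTruncation_projM hr hgap
  obtain ⟨N', H', h'⟩ := exists_isTruncation_projM hr hgap'
  have hp := IsTruncation.sigma_sq_sub_pos hgap
  have h1 := h.norm_sub_sq_le ((sigma_nonneg _ _).trans_lt hgap) h'.pinv h'.rank_eq
  have h2 := (h'.isNearest hr hgap').2 _ h.rank_eq
  have hl := h.left_mul_eq
  have hl' := h'.left_mul_eq
  have h8 := h.pinv.left.norm_sub_mul_le h'.pinv.left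
    (by rw [h.pinv.trace_left, h'.pinv.trace_left, h.rank_eq, h'.rank_eq]) A
  have hc := h'.pinv.left.norm_mul_le (A' - A)
  set R := projM r A
  set R' := projM r A'
  have h3 : ‖A - R'‖ ≤ ‖A - R‖ + 2 * ‖A' - A‖ := by
    have a1 : ‖A - R'‖ ≤ ‖A' - R'‖ + ‖A' - A‖ := by
      have := norm_sub_le (A' - R') (A' - A)
      rwa [sub_sub_sub_cancel_left, ← neg_sub, neg_sub R'] at this
    have a2 : ‖A' - R‖ ≤ ‖A - R‖ + ‖A' - A‖ := by
      have := norm_add_le (A - R) (A' - A)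
      rwa [add_comm (A - R), sub_add_sub_cancel] at this
    linarith
  have h4 := pow_le_pow_left₀ (norm_nonneg _) h3 2
  have h5 : ‖(1 - R' * H') * (R * H)‖ ≤ √(((‖A - R‖ + 2 * ‖A' - A‖) ^ 2 - ‖A - R‖ ^ 2) /
      (sigma r A ^ 2 - sigma (r + 1) A ^ 2)) := by
    refine Real.le_sqrt_of_sq_le ?_
    rw [le_div_iff₀ hp]
    nlinarith [sq_nonneg ‖R' * H' * A - R'‖]
  have e : R' - R = R' * H' * (A' - A) + (R' * H' - R * H) * A := by
    conv_lhs => rw [← hl', ← hl]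
    rw [Matrix.mul_sub, Matrix.sub_mul]
    abel
  rw [e]
  refine (norm_add_le _ _).trans (add_le_add hc (h8.trans ?_))
  exact mul_le_mul_of_nonneg_right h5 (norm_nonneg _)

theorem continuousOn_projM (hr : 1 ≤ r) :
    ContinuousOn (projM r) (gapSet r l m) := by
  intro A hA
  refine tendsto_iff_norm_sub_tendsto_zero.2 ?_
  refine squeeze_zero' (Eventually.of_forall fun _ => norm_nonneg _)
    (eventually_mem_nhdsWithin.mono fun A' hA' => norm_projM_sub_le hr hA hA') ?_
  have hc : Continuous fun A' => ‖A' - A‖ + √(((‖A - projM r A‖ + 2 * ‖A' - A‖) ^ 2 -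
      ‖A - projM r A‖ ^ 2) / (sigma r A ^ 2 - sigma (r + 1) A ^ 2)) * ‖A‖ := by fun_prop
  have := hc.tendsto A
  simp only [sub_self, norm_zero, mul_zero, add_zero, zero_div, Real.sqrt_zero, zero_mul] at this
  exact this.mono_left nhdsWithin_le_nhds

end Nearest

end LowRank

end

noncomputable section

namespace LowRank

attribute [local instance] frobeniusInnerProductSpace

/-! ### Differentiating the projection onto the manifold. -/

section Derivative

variable {l m r : ℕ} {A R N : Matrix (Fin l) (Fin m) ℝ} {H : Matrix (Fin m) (Fin l) ℝ}

/-- The Weingarten map, in the normal direction `N`, of the manifold of matrices of fixed rank at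
the point whose Moore–Penrose inverse is `H`. -/
def weingarten (N : Matrix (Fin l) (Fin m) ℝ) (H : Matrix (Fin m) (Fin l) ℝ) :
    Matrix (Fin l) (Fin m) ℝ →ₗ[ℝ] Matrix (Fin l) (Fin m) ℝ where
  toFun Y := N * Yᵀ * Hᵀ + Hᵀ * Yᵀ * N
  map_add' Y Z := by
    simp only [Matrix.transpose_add, Matrix.mul_add, Matrix.add_mul]
    abel
  map_smul' a Y := by simp

theorem weingarten_apply (N : Matrix (Fin l) (Fin m) ℝ) (H : Matrix (Fin m) (Fin l) ℝ)
    (Y : Matrix (Fin l) (Fin m) ℝ) : weingarten N H Y = N * Yᵀ * Hᵀ + Hᵀ * Yᵀ * N := rfl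

/-- The orthogonal projection on the tangent space at a matrix with Moore–Penrose inverse `H`. -/
def tangentProj (R : Matrix (Fin l) (Fin m) ℝ) (H : Matrix (Fin m) (Fin l) ℝ) :
    Matrix (Fin l) (Fin m) ℝ →ₗ[ℝ] Matrix (Fin l) (Fin m) ℝ :=
  LinearMap.id - (mulMulCLM (1 - R * H) (1 - H * R)).toLinearMap

theorem tangentProj_apply (R : Matrix (Fin l) (Fin m) ℝ) (H : Matrix (Fin m) (Fin l) ℝ)
    (Y : Matrix (Fin l) (Fin m) ℝ) :
    tangentProj R H Y = Y - (1 - R * H) * Y * (1 - H * R) := rfl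

theorem PInv.norm_tangentProj_le {c : ℝ} (h : PInv R H c) (hr : 1 ≤ r) (hR : R.rank = r)
    (Y : Matrix (Fin l) (Fin m) ℝ) : ‖tangentProj R H Y‖ ≤ ‖Y‖ := by
  rw [tangentProj_apply, ← projT_eq hr h hR]
  exact (tangentSpace r R).norm_starProjection_apply_le Y

namespace IsTruncation

/-- The two terms are orthogonal because HN = 0, and they see the complementary parts RHY and (1 -
RH)Y. Pythagoras then gives σ_{r+1}/σ_r without a factor 2. -/
theorem norm_weingarten_le (h : IsTruncation r A R N H) (Y : Matrix (Fin l) (Fin m) ℝ) :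
    ‖weingarten N H Y‖ ≤ sigma (r + 1) A / sigma r A * ‖Y‖ := by
  have hP := h.pinv.left
  have hHN : H * N = 0 := by
    rw [← h.pinv.mul_mul_inv, Matrix.mul_assoc H, Matrix.mul_assoc H, h.left_mul, Matrix.mul_zero]
  have hHP : R * H * Hᵀ = Hᵀ := by
    rw [← h.pinv.symm_left, ← Matrix.transpose_mul, ← Matrix.mul_assoc, h.pinv.mul_mul_inv]
  have hPN : (1 - R * H) * N = N := by
    rw [Matrix.sub_mul, h.left_mul, Matrix.one_mul, sub_zero]
  have e1 : N * Yᵀ * Hᵀ = N * ((R * H * Y)ᵀ * Hᵀ) := by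
    rw [Matrix.transpose_mul, hP.symm, Matrix.mul_assoc Yᵀ, hHP, Matrix.mul_assoc]
  have e2 : Hᵀ * Yᵀ * N = Hᵀ * (((1 - R * H) * Y)ᵀ * N) := by
    rw [Matrix.transpose_mul, hP.one_sub.symm, Matrix.mul_assoc Yᵀ, hPN, Matrix.mul_assoc]
  have b1 : ‖N * Yᵀ * Hᵀ‖ ≤ sigma (r + 1) A / sigma r A * ‖R * H * Y‖ := by
    rw [e1, div_eq_mul_inv, mul_assoc]
    refine (h.bound.2 _ _).trans (mul_le_mul_of_nonneg_left ?_ h.bound.1)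
    have := h.pinv.bound.transpose.norm_mul_right_le (R * H * Y)ᵀ
    rwa [Matrix.frobenius_norm_transpose] at this
  have b2 : ‖Hᵀ * Yᵀ * N‖ ≤ sigma (r + 1) A / sigma r A * ‖(1 - R * H) * Y‖ := by
    rw [e2, div_eq_inv_mul, mul_assoc]
    refine (h.pinv.bound.transpose.2 _ _).trans (mul_le_mul_of_nonneg_left ?_ h.pinv.bound.1)
    have := h.bound.norm_mul_right_le ((1 - R * H) * Y)ᵀ
    rwa [Matrix.frobenius_norm_transpose] at this
  have e3 : ‖weingarten N H Y‖ ^ 2 = ‖N * Yᵀ * Hᵀ‖ ^ 2 + ‖Hᵀ * Yᵀ * N‖ ^ 2 := by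
    rw [weingarten_apply, norm_add_sq_of_trace_eq_zero]
    have : (N * Yᵀ * Hᵀ)ᵀ * (Hᵀ * Yᵀ * N) = H * Y * (H * N)ᵀ * Yᵀ * N := by
      simp only [Matrix.transpose_mul, Matrix.transpose_transpose, Matrix.mul_assoc]
    rw [this, hHN]
    simp
  have e4 := hP.norm_sq_add_norm_sq Y
  have hq : 0 ≤ sigma (r + 1) A / sigma r A := div_nonneg (sigma_nonneg _ _) (sigma_nonneg _ _)
  refine le_of_sq_le_sq ?_ (by positivity)
  have c1 := pow_le_pow_left₀ (norm_nonneg _) b1 2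
  have c2 := pow_le_pow_left₀ (norm_nonneg _) b2 2
  rw [mul_pow] at c1 c2 ⊢
  rw [e3, ← e4]
  linarith

theorem le_norm_sub_weingarten (h : IsTruncation r A R N H) (Y : Matrix (Fin l) (Fin m) ℝ) :
    (1 - sigma (r + 1) A / sigma r A) * ‖Y‖ ≤ ‖Y - weingarten N H Y‖ := by
  linarith [h.norm_weingarten_le Y, norm_sub_norm_le Y (weingarten N H Y)]

theorem ratio_lt_one (hgap : sigma (r + 1) A < sigma r A) :
    sigma (r + 1) A / sigma r A < 1 :=
  (div_lt_one ((sigma_nonneg _ _).trans_lt hgap)).2 hgap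

/-- The derivative of the projection on the manifold solves a linear equation involving the
curvature of the manifold. -/
theorem exists_derivative (h : IsTruncation r A R N H) (hgap : sigma (r + 1) A < sigma r A) :
    ∃ D : Matrix (Fin l) (Fin m) ℝ →L[ℝ] Matrix (Fin l) (Fin m) ℝ,
      ∀ X, D X - weingarten N H (D X) = tangentProj R H X := by
  -- `weingarten N H` has norm below 1, and injectivity suffices for invertibility in finite
  -- dimension.
  have hinj : Function.Injective
      (LinearMap.id - weingarten N H :
        Matrix (Fin l) (Fin m) ℝ →ₗ[ℝ] Matrix (Fin l) (Fin m) ℝ) := by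
    refine (injective_iff_map_eq_zero _).2 fun Y hY => ?_
    have h1 := h.le_norm_sub_weingarten Y
    have h2 : Y - weingarten N H Y = 0 := hY
    rw [h2, norm_zero] at h1
    have h3 := ratio_lt_one hgap
    exact norm_le_zero_iff.1 (nonpos_of_mul_nonpos_right h1 (by linarith))
  let e := LinearEquiv.ofInjectiveEndo _ hinj
  refine ⟨LinearMap.toContinuousLinearMap (e.symm.toLinearMap ∘ₗ tangentProj R H), fun X => ?_⟩
  exact e.apply_symm_apply (tangentProj R H X)

/-- Expanding N'R'ᵀ = 0 and R'ᵀN' = 0 around (R, N) without dropping anything gives an exact form of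
the linearized equation. Everything on the right is of second order, the normal part by
`PInv.norm_normal_le`. -/
theorem sub_weingarten_sub_tangentProj (h : IsTruncation r A R N H)
    {A' R' N' : Matrix (Fin l) (Fin m) ℝ} {H' : Matrix (Fin m) (Fin l) ℝ}
    (h' : IsTruncation r A' R' N' H') :
    (R' - R) - weingarten N H (R' - R) - tangentProj R H (A' - A) =
      (1 - R * H) * (R' - R) * (1 - H * R) -
        (((R' - R) - (A' - A)) * (R' - R)ᵀ * Hᵀ +
          Hᵀ * (R' - R)ᵀ * ((R' - R) - (A' - A)) * (1 - H * R)) := by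
  have hN : N' = N - ((R' - R) - (A' - A)) := by
    rw [h.eq_add, h'.eq_add]; abel
  have hR : R' = R + (R' - R) := by abel
  generalize A' - A = X at *
  generalize R' - R = D at *
  have hNR : N * Rᵀ = 0 := by
    rw [← Matrix.transpose_transpose (N * Rᵀ), Matrix.transpose_mul, Matrix.transpose_transpose,
      h.mul_transpose, Matrix.transpose_zero]
  have hNR' : N' * R'ᵀ = 0 := by
    rw [← Matrix.transpose_transpose (N' * R'ᵀ), Matrix.transpose_mul, Matrix.transpose_transpose,
      h'.mul_transpose, Matrix.transpose_zero]
  have hRN' := h'.transpose_mul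
  have hRN := h.transpose_mul
  have a1 : N * Dᵀ = (D - X) * Rᵀ + (D - X) * Dᵀ := by
    rw [hN, hR, Matrix.sub_mul, Matrix.transpose_add, Matrix.mul_add, Matrix.mul_add, hNR,
      zero_add, sub_eq_zero] at hNR'
    exact hNR'
  have a2 : Dᵀ * N = Rᵀ * (D - X) + Dᵀ * (D - X) := by
    rw [hN, hR, Matrix.mul_sub, Matrix.transpose_add, Matrix.add_mul, Matrix.add_mul, hRN,
      zero_add, sub_eq_zero] at hRN'
    exact hRN'
  have b1 : N * Dᵀ * Hᵀ = (D - X) * (H * R) + (D - X) * Dᵀ * Hᵀ := by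
    rw [a1, Matrix.add_mul, Matrix.mul_assoc _ Rᵀ, h.pinv.transpose_mul_transpose_left]
  have hNQ : N * (1 - H * R) = N := by
    rw [Matrix.mul_sub, h.mul_right, Matrix.mul_one, sub_zero]
  have b2 : Hᵀ * Dᵀ * N = R * H * (D - X) * (1 - H * R) + Hᵀ * Dᵀ * (D - X) * (1 - H * R) := by
    have : Hᵀ * Dᵀ * N = Hᵀ * (Dᵀ * N) * (1 - H * R) := by
      rw [Matrix.mul_assoc Hᵀ, Matrix.mul_assoc Hᵀ, Matrix.mul_assoc Dᵀ, hNQ]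
    rw [this, a2, Matrix.mul_add, Matrix.add_mul, ← Matrix.mul_assoc Hᵀ Rᵀ,
      h.pinv.transpose_mul_transpose_right, Matrix.mul_assoc Hᵀ Dᵀ]
  rw [weingarten_apply, tangentProj_apply, b1, b2]
  generalize R * H = P
  generalize H * R = Q
  generalize (D - X) * Dᵀ * Hᵀ = E₁
  generalize Hᵀ * Dᵀ * (D - X) * (1 - Q) = E₂
  simp only [Matrix.sub_mul, Matrix.mul_sub, Matrix.one_mul, Matrix.mul_one]
  abel

theorem norm_sub_weingarten_sub_le (h : IsTruncation r A R N H)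
    {A' R' N' : Matrix (Fin l) (Fin m) ℝ} {H' : Matrix (Fin m) (Fin l) ℝ}
    (h' : IsTruncation r A' R' N' H') :
    ‖(R' - R) - weingarten N H (R' - R) - tangentProj R H (A' - A)‖ ≤
      3 * (sigma r A)⁻¹ * (‖R' - R‖ * (‖R' - R‖ + ‖A' - A‖)) := by
  rw [h.sub_weingarten_sub_tangentProj h']
  have hc := h.pinv.bound.1
  have b0 := h.pinv.norm_normal_le h'.pinv (h.rank_eq.trans h'.rank_eq.symm)
  have hQ := h.pinv.right.one_sub
  have bH := h.pinv.bound.transpose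
  generalize A' - A = X at *
  generalize R' - R = D at *
  generalize (sigma r A)⁻¹ = c at *
  have b1 : ‖(D - X) * Dᵀ * Hᵀ‖ ≤ c * ((‖D‖ + ‖X‖) * ‖D‖) := by
    refine (bH.norm_mul_right_le _).trans (mul_le_mul_of_nonneg_left ?_ hc)
    refine (Matrix.frobenius_norm_mul _ _).trans ?_
    rw [Matrix.frobenius_norm_transpose]
    exact mul_le_mul_of_nonneg_right (norm_sub_le _ _) (norm_nonneg _)
  have b2 : ‖Hᵀ * Dᵀ * (D - X) * (1 - H * R)‖ ≤ c * (‖D‖ * (‖D‖ + ‖X‖)) := by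
    refine (hQ.norm_mul_right_le _).trans ?_
    rw [Matrix.mul_assoc]
    refine (bH.2 _ _).trans (mul_le_mul_of_nonneg_left ?_ hc)
    refine (Matrix.frobenius_norm_mul _ _).trans ?_
    rw [Matrix.frobenius_norm_transpose]
    exact mul_le_mul_of_nonneg_left (norm_sub_le _ _) (norm_nonneg _)
  refine (norm_sub_le _ _).trans ?_
  have b3 := norm_add_le ((D - X) * Dᵀ * Hᵀ) (Hᵀ * Dᵀ * (D - X) * (1 - H * R))
  have b4 : 0 ≤ c * (‖D‖ * ‖X‖) := by positivity
  nlinarith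

theorem norm_sub_le_of_eq (h : IsTruncation r A R N H) {X Y : Matrix (Fin l) (Fin m) ℝ}
    (hY : Y - weingarten N H Y = X) (Z : Matrix (Fin l) (Fin m) ℝ) :
    (1 - sigma (r + 1) A / sigma r A) * ‖Z - Y‖ ≤ ‖Z - weingarten N H Z - X‖ := by
  refine (h.le_norm_sub_weingarten _).trans_eq (congrArg norm ?_)
  rw [← hY, (weingarten N H).map_sub]
  abel

/-- The difference is W(Y), with ‖W‖ ≤ σ_{r+1}/σ_r and ‖Y‖ ≤ σ_r‖X‖/(σ_r - σ_{r+1}). Weyl's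
inequality, with σ_{r+1}(R) = 0, turns the remaining σ_{r+1} into ‖A - R‖. -/
theorem norm_derivative_sub_le (h : IsTruncation r A R N H) (hr : 1 ≤ r)
    (hgap : sigma (r + 1) A < sigma r A) {X Y : Matrix (Fin l) (Fin m) ℝ}
    (hY : Y - weingarten N H Y = tangentProj R H X) :
    ‖Y - tangentProj R H X‖ ≤ ‖A - R‖ / (sigma r A - sigma (r + 1) A) * ‖X‖ := by
  have h1 := h.le_norm_sub_weingarten Y
  rw [hY] at h1
  have h2 := h1.trans (h.pinv.norm_tangentProj_le hr h.rank_eq X)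
  have h3 := h.norm_weingarten_le Y
  have h4 : Y - tangentProj R H X = weingarten N H Y := by rw [← hY, sub_sub_cancel]
  have hs : 0 < sigma r A := (sigma_nonneg _ _).trans_lt hgap
  have h5 : sigma (r + 1) A ≤ ‖A - R‖ := by
    have := sigma_le_add_norm_sub (k := r + 1) (by omega) A R
    have h0 : sigma (r + 1) R = 0 := by
      refine le_antisymm ?_ (sigma_nonneg _ _)
      by_contra hc
      have := (sigma_pos_iff (by omega) R).1 (not_le.1 hc)
      have := h.rank_eq
      omega
    rwa [h0, zero_add] at this
  rw [h4]
  have ht := sigma_nonneg (r + 1) A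
  set s := sigma r A
  set t := sigma (r + 1) A
  have h6 : (s - t) * ‖Y‖ ≤ s * ‖X‖ := by
    have := mul_le_mul_of_nonneg_left h2 hs.le
    rwa [← mul_assoc, mul_sub, mul_one, mul_div_cancel₀ _ hs.ne'] at this
  have hst : 0 < s - t := by linarith
  refine h3.trans ?_
  rw [div_mul_eq_mul_div, div_mul_eq_mul_div, div_le_div_iff₀ hs hst]
  calc t * ‖Y‖ * (s - t) = t * ((s - t) * ‖Y‖) := by ring
    _ ≤ ‖A - R‖ * (s * ‖X‖) := by gcongr
    _ = ‖A - R‖ * ‖X‖ * s := by ring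

end IsTruncation

theorem hasFDerivWithinAt_projM (hr : 1 ≤ r) (hA : A ∈ gapSet r l m)
    (h : IsTruncation r A (projM r A) N H)
    {D : Matrix (Fin l) (Fin m) ℝ →L[ℝ] Matrix (Fin l) (Fin m) ℝ}
    (hD : ∀ X, D X - weingarten N H (D X) = tangentProj (projM r A) H X) :
    HasFDerivWithinAt (projM r) D (gapSet r l m) A := by
  set q := sigma (r + 1) A / sigma r A
  have hq : 0 < 1 - q := sub_pos.2 (IsTruncation.ratio_lt_one hA)
  set c := 3 * (sigma r A)⁻¹
  have hc : 0 ≤ c := mul_nonneg (by norm_num) h.pinv.bound.1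
  have key : ∀ A' ∈ gapSet r l m, ‖(projM r A' - projM r A) -
      weingarten N H (projM r A' - projM r A) - tangentProj (projM r A) H (A' - A)‖ ≤
      c * (‖projM r A' - projM r A‖ * (‖projM r A' - projM r A‖ + ‖A' - A‖)) := by
    intro A' hA'
    obtain ⟨N', H', h'⟩ := exists_isTruncation_projM hr hA'
    exact h.norm_sub_weingarten_sub_le h'
  have hlim : Tendsto (fun A' => ‖projM r A' - projM r A‖) (𝓝[gapSet r l m] A) (𝓝 0) :=
    tendsto_iff_norm_sub_tendsto_zero.1 (continuousOn_projM hr A hA)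
  -- With d and x the increments of the projection and of the matrix, (1 - q)d ≤ x + c d(d + x).
  -- Continuity makes c d at most (1 - q)/2, so half of the left side absorbs the quadratic term.
  -- This Lipschitz bound then makes the remainder o(x).
  have hO : (fun A' => ‖projM r A' - projM r A‖) =O[𝓝[gapSet r l m] A] fun A' => ‖A' - A‖ := by
    refine Asymptotics.IsBigO.of_bound ((1 + (1 - q) / 2) / ((1 - q) / 2)) ?_
    have hs : Tendsto (fun A' => c * ‖projM r A' - projM r A‖) (𝓝[gapSet r l m] A) (𝓝 0) := by
      simpa using hlim.const_mul c
    filter_upwards [eventually_mem_nhdsWithin, hs.eventually_lt_const (half_pos hq)] with A' hA' h1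
    have h2 := key A' hA'
    have h3 := h.le_norm_sub_weingarten (projM r A' - projM r A)
    have h4 := h.pinv.norm_tangentProj_le hr h.rank_eq (A' - A)
    have h5 := norm_sub_norm_le (projM r A' - projM r A - weingarten N H (projM r A' - projM r A))
      (tangentProj (projM r A) H (A' - A))
    rw [norm_norm, norm_norm, div_mul_eq_mul_div, le_div_iff₀ (half_pos hq)]
    set x := ‖A' - A‖
    set d := ‖projM r A' - projM r A‖
    have hx : 0 ≤ x := norm_nonneg _
    have hd : 0 ≤ d := norm_nonneg _
    have h6 : c * (d * (d + x)) ≤ (1 - q) / 2 * (d + x) := by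
      rw [← mul_assoc]
      exact mul_le_mul_of_nonneg_right h1.le (by positivity)
    linarith
  have ho : (fun A' => projM r A' - projM r A - D (A' - A)) =o[𝓝[gapSet r l m] A]
      fun A' => A' - A := by
    have b1 : (fun A' => projM r A' - projM r A - D (A' - A)) =O[𝓝[gapSet r l m] A]
        fun A' => ‖projM r A' - projM r A‖ * (‖projM r A' - projM r A‖ + ‖A' - A‖) := by
      refine Asymptotics.IsBigO.of_bound (c / (1 - q)) ?_
      filter_upwards [eventually_mem_nhdsWithin] with A' hA'
      have h4 := (h.norm_sub_le_of_eq (hD (A' - A)) _).trans (key A' hA')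
      rw [Real.norm_of_nonneg (by positivity), div_mul_eq_mul_div, le_div_iff₀ hq, mul_comm]
      exact h4
    have b2 : (fun A' => ‖projM r A' - projM r A‖ * (‖projM r A' - projM r A‖ + ‖A' - A‖))
        =o[𝓝[gapSet r l m] A] fun A' => (1 : ℝ) * ‖A' - A‖ :=
      ((Asymptotics.isLittleO_one_iff ℝ).2 hlim).mul_isBigO
        (hO.add (Asymptotics.isBigO_refl _ _))
    simp only [one_mul] at b2
    exact (b1.trans_isLittleO b2).of_norm_right
  exact HasFDerivWithinAt.of_isLittleO ho

/-- Along a curve, the projection on the matrices of rank `r` follows the tangential part of the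
velocity up to a curvature term. -/
theorem exists_hasDerivWithinAt_projM (hr : 1 ≤ r) {F : ℝ → Matrix (Fin l) (Fin m) ℝ}
    {s : Set ℝ} (hF : ∀ t ∈ s, F t ∈ gapSet r l m) {t : ℝ} (ht : t ∈ s)
    {X : Matrix (Fin l) (Fin m) ℝ} (hX : HasDerivWithinAt F X s t) :
    ∃ Y, HasDerivWithinAt (fun t => projM r (F t)) Y s t ∧
      ‖Y - projT r (projM r (F t)) X‖ ≤
        ‖F t - projM r (F t)‖ / (sigma r (F t) - sigma (r + 1) (F t)) * ‖X‖ := by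
  have hA := hF t ht
  obtain ⟨N, H, h⟩ := exists_isTruncation_projM hr hA
  obtain ⟨D, hD⟩ := h.exists_derivative hA
  refine ⟨D X, ?_, ?_⟩
  · exact (hasFDerivWithinAt_projM hr hA h hD).comp_hasDerivWithinAt t hX hF
  · rw [projT_eq hr h.pinv h.rank_eq, ← tangentProj_apply]
    exact h.norm_derivative_sub_le hr hA (hD X)

end Derivative

end LowRank

end

noncomputable section

namespace LowRank

/-! ### Grönwall's inequality and measurability of derivatives. -/

section Gronwall

/-- A Grönwall inequality in integral form, for a merely integrable source term. -/
theorem norm_le_integral_of_norm_deriv_le {E : Type*} [NormedAddCommGroup E]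
    [InnerProductSpace ℝ E] {e e' : ℝ → E} {a : ℝ → ℝ} {T η : ℝ} (hT : 0 ≤ T) (hη : 0 ≤ η)
    (he : ∀ t ∈ Icc 0 T, HasDerivWithinAt e (e' t) (Icc 0 T) t) (h0 : e 0 = 0)
    (hb : ∀ t ∈ Icc 0 T, ‖e' t‖ ≤ η * ‖e t‖ + a t)
    (hint : IntegrableOn (fun s => a s * Real.exp (η * (T - s))) (Icc 0 T)) :
    ‖e T‖ ≤ ∫ s in (0 : ℝ)..T, a s * Real.exp (η * (T - s)) := by
  have hcont : ContinuousOn e (Icc 0 T) := fun t ht => (he t ht).continuousWithinAt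
  have key : ∀ ε : ℝ, 0 < ε →
      ‖e T‖ ≤ (∫ s in (0 : ℝ)..T, a s * Real.exp (η * (T - s))) + ε * Real.exp (η * T) := by
    intro ε hε
    -- The norm is not differentiable at 0, so it is smoothed. The exponential weight cancels the
    -- term ηG in the derivative, and G(0) = ε accounts for the extra ε exp(ηT).
    set G : ℝ → ℝ := fun s => √(‖e s‖ ^ 2 + ε ^ 2)
    have hpos : ∀ s, 0 < ‖e s‖ ^ 2 + ε ^ 2 := fun s => by positivity
    have hG : ∀ s, ‖e s‖ ≤ G s := fun s => Real.le_sqrt_of_sq_le (by nlinarith [sq_nonneg ε])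
    have hGpos : ∀ s, 0 < G s := fun s => Real.sqrt_pos.2 (hpos s)
    have hd : ∀ s ∈ Ioo 0 T, HasDerivAt (fun s => G s * Real.exp (η * (T - s)))
        ((2 * inner ℝ (e s) (e' s) / (2 * G s)) * Real.exp (η * (T - s)) +
          G s * (Real.exp (η * (T - s)) * (η * (0 - 1)))) s := by
      intro s hs
      have h1 : HasDerivAt e (e' s) s :=
        (he s (Ioo_subset_Icc_self hs)).hasDerivAt (Icc_mem_nhds hs.1 hs.2)
      have h2 := (h1.norm_sq.add_const (ε ^ 2)).sqrt (hpos s).ne'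
      have h3 : HasDerivAt (fun s => Real.exp (η * (T - s)))
          (Real.exp (η * (T - s)) * (η * (0 - 1))) s :=
        ((((hasDerivAt_const s T).sub (hasDerivAt_id s)).const_mul η).exp)
      exact h2.mul h3
    have hle := intervalIntegral.sub_le_integral_of_hasDeriv_right_of_le
      (g := fun s => G s * Real.exp (η * (T - s))) hT
      (((hcont.norm.pow 2).add continuousOn_const).sqrt.mul (by fun_prop))
      (fun s hs => (hd s hs).hasDerivWithinAt) hint (fun s hs => by
        have hs' := Ioo_subset_Icc_self hs
        have hx := Real.exp_pos (η * (T - s))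
        have h4 : inner ℝ (e s) (e' s) ≤ G s * (η * G s + a s) := by
          refine (real_inner_le_norm _ _).trans ?_
          have h5 : ‖e' s‖ ≤ η * G s + a s :=
            (hb s hs').trans (add_le_add_left (mul_le_mul_of_nonneg_left (hG s) hη) _)
          exact mul_le_mul (hG s) h5 (norm_nonneg _) (hGpos s).le
        have h6 : 2 * inner ℝ (e s) (e' s) / (2 * G s) ≤ η * G s + a s := by
          rw [div_le_iff₀ (by have := hGpos s; positivity)]
          linarith
        nlinarith [mul_le_mul_of_nonneg_right h6 hx.le])
    have hGT := hG T
    simp only [sub_self, mul_zero, Real.exp_zero, mul_one, sub_zero] at hle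
    have hG0 : G 0 = ε := by simp [G, h0, Real.sqrt_sq hε.le]
    rw [hG0] at hle
    linarith
  refine le_of_forall_pos_le_add fun δ hδ => ?_
  have := key (δ / Real.exp (η * T)) (by positivity)
  rwa [div_mul_cancel₀ _ (Real.exp_pos _).ne'] at this

/-- 𝓛 carries no measurability assumption in time, but along the full solution it is a derivative,
and derivatives are measurable. -/
theorem aestronglyMeasurable_norm_of_hasDerivWithinAt {E : Type*} [NormedAddCommGroup E]
    [NormedSpace ℝ E] [CompleteSpace E] {f f' : ℝ → E} {a b : ℝ}
    (hf : ∀ t ∈ Icc a b, HasDerivWithinAt f (f' t) (Icc a b) t) :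
    AEStronglyMeasurable (fun t => ‖f' t‖) (volume.restrict (Icc a b)) := by
  borelize E
  rw [← Measure.restrict_congr_set (Ioo_ae_eq_Icc (μ := volume) (a := a) (b := b))]
  refine ((measurable_deriv f).norm.aestronglyMeasurable).congr ?_
  refine (ae_restrict_mem measurableSet_Ioo).mono fun t ht => ?_
  change ‖deriv f t‖ = ‖f' t‖
  rw [((hf t (Ioo_subset_Icc_self ht)).hasDerivAt (Icc_mem_nhds ht.1 ht.2)).deriv]

end Gronwall

attribute [local instance] frobeniusInnerProductSpace

/-! ### The differential inequality for the error. -/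

section Error

variable {l m r : ℕ} {K T : ℝ}
  {L : ℝ → Matrix (Fin l) (Fin m) ℝ → Matrix (Fin l) (Fin m) ℝ}
  {F R : ℝ → Matrix (Fin l) (Fin m) ℝ}

theorem norm_projT_le (B X : Matrix (Fin l) (Fin m) ℝ) : ‖projT r B X‖ ≤ ‖X‖ :=
  (tangentSpace r B).norm_starProjection_apply_le X

theorem projT_sub (B X Y : Matrix (Fin l) (Fin m) ℝ) :
    projT r B X - projT r B Y = projT r B (X - Y) :=
  ((tangentSpace r B).starProjection.map_sub X Y).symm

/-- The tangent projections at the nearest matrix of rank `r` and at any other matrix of rank `r`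
are close to each other. -/
theorem norm_projT_sub_projT_le (hr : 1 ≤ r) {A B : Matrix (Fin l) (Fin m) ℝ}
    (hA : A ∈ gapSet r l m) (hB : B.rank = r) (X : Matrix (Fin l) (Fin m) ℝ) :
    ‖projT r B X - projT r (projM r A) X‖ ≤ 2 / sigma r A * ‖X‖ * ‖B - projM r A‖ := by
  obtain ⟨N, H, h⟩ := exists_isTruncation_projM hr hA
  obtain ⟨H', h'⟩ := exists_pinv hr hB
  rw [projT_eq hr h.pinv h.rank_eq, projT_eq hr h' hB, sub_sub_sub_cancel_left]
  refine (h.pinv.norm_normal_sub_le h' (h.rank_eq.trans hB.symm) X).trans_eq ?_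
  rw [norm_sub_rev (projM r A)]
  ring

/-- All factors are continuous except ‖𝓛(s, F(s))‖, which is measurable, and bounded because
2‖𝓛‖/σ_r and σ_r both are on [0, T]. -/
theorem integrableOn_errorIntegrand (hr : 1 ≤ r) (hF : IsFullSolution T L F)
    (hgap : ∀ t ∈ Icc 0 T, F t ∈ gapSet r l m) (hη : BddAbove (growthValues r T L F)) (t : ℝ) :
    IntegrableOn (errorIntegrand r K T L F t) (Icc 0 T) := by
  have hFc : ContinuousOn F (Icc 0 T) := fun s hs => (hF s hs).continuousWithinAt
  have hσ : ∀ k, 1 ≤ k → ContinuousOn (fun s => sigma k (F s)) (Icc 0 T) := fun k hk =>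
    (continuous_sigma hk).comp_continuousOn hFc
  have hP : ContinuousOn (fun s => projM r (F s)) (Icc 0 T) :=
    (continuousOn_projM hr).comp hFc hgap
  have hu : ContinuousOn (fun s => ‖F s - projM r (F s)‖ *
      Real.exp (growthRate r K T L F * (t - s))) (Icc 0 T) :=
    (hFc.sub hP).norm.mul (by fun_prop)
  have hv : ContinuousOn (fun s => (sigma r (F s) - sigma (r + 1) (F s))⁻¹) (Icc 0 T) :=
    ((hσ r hr).sub (hσ (r + 1) (by omega))).inv₀ fun s hs => (sub_pos.2 (hgap s hs)).ne'
  have hw : IntegrableOn (fun s => ‖L s (F s)‖) (Icc 0 T) := by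
    obtain ⟨M, hM⟩ := hη
    obtain ⟨S, hS⟩ := isCompact_Icc.bddAbove_image (hσ r hr)
    refine Integrable.of_bound (aestronglyMeasurable_norm_of_hasDerivWithinAt hF) (M * S / 2) ?_
    refine (ae_restrict_mem measurableSet_Icc).mono fun s hs => ?_
    have h1 : 2 / sigma r (F s) * ‖L s (F s)‖ ≤ M := hM (mem_image_of_mem _ hs)
    have h2 : sigma r (F s) ≤ S := hS (mem_image_of_mem _ hs)
    have h3 : 0 < sigma r (F s) := (sigma_nonneg _ _).trans_lt (hgap s hs)
    have h4 : 0 ≤ M := le_trans (by positivity) h1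
    rw [norm_norm]
    rw [div_mul_eq_mul_div, div_le_iff₀ h3] at h1
    nlinarith [mul_le_mul_of_nonneg_left h2 h4]
  have h1 : IntegrableOn (fun s => ‖F s - projM r (F s)‖ *
      Real.exp (growthRate r K T L F * (t - s)) * K) (Icc 0 T) :=
    (hu.mul continuousOn_const).integrableOn_compact isCompact_Icc
  have h2 := hw.continuousOn_mul (hu.mul hv) isCompact_Icc
  refine (h1.add h2).congr (Eventually.of_forall fun s => ?_)
  simp only [errorIntegrand, Pi.add_apply, Pi.mul_apply]
  ring

theorem IsDOSolution.norm_sub_projM_le (hr : 1 ≤ r) (hF : IsFullSolution T L F)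
    (hR : IsDOSolution r T L F R)
    (hL : ∀ t ∈ Icc 0 T, ∀ A B : Matrix (Fin l) (Fin m) ℝ, ‖L t A - L t B‖ ≤ K * ‖A - B‖)
    (hgap : ∀ t ∈ Icc 0 T, F t ∈ gapSet r l m) (hη : BddAbove (growthValues r T L F)) {t : ℝ}
    (ht : t ∈ Icc 0 T) :
    ‖R t - projM r (F t)‖ ≤ ∫ s in (0 : ℝ)..t, errorIntegrand r K T L F t s := by
  -- The Lipschitz bound between `R t` and 0 forces this, since `R t` is nonzero, having rank at
  -- least 1.
  have hK : 0 ≤ K := by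
    have h1 := hL t ht (R t) 0
    have h2 : R t ≠ 0 := by
      intro h
      have := hR.rank_eq t ht
      rw [h, Matrix.rank_zero] at this
      omega
    rw [sub_zero] at h1
    exact nonneg_of_mul_nonneg_left ((norm_nonneg _).trans h1) (norm_pos_iff.2 h2)
  have hgrow : ∀ s ∈ Icc 0 T, 2 / sigma r (F s) * ‖L s (F s)‖ ≤ sSup (growthValues r T L F) :=
    fun s hs => le_csSup hη (mem_image_of_mem _ hs)
  have hηnn : 0 ≤ growthRate r K T L F := by
    refine add_nonneg hK (le_trans ?_ (hgrow t ht))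
    exact mul_nonneg (div_nonneg two_pos.le (sigma_nonneg _ _)) (norm_nonneg _)
  have hsub : Icc 0 t ⊆ Icc 0 T := Icc_subset_Icc_right ht.2
  have hY := fun s (hs : s ∈ Icc 0 T) => exists_hasDerivWithinAt_projM hr hgap hs (hF s hs)
  choose! Y hYd hYb using hY
  refine norm_le_integral_of_norm_deriv_le (e := fun s => R s - projM r (F s))
    (e' := fun s => projT r (R s) (L s (R s)) - Y s)
    (a := fun s => ‖F s - projM r (F s)‖ *
      (K + ‖L s (F s)‖ / (sigma r (F s) - sigma (r + 1) (F s)))) (η := growthRate r K T L F)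
    ht.1 hηnn (fun s hs => ?_) ?_ (fun s hs => ?_) ?_
  · exact ((hR.deriv_eq s (hsub hs)).sub (hYd s (hsub hs))).mono hsub
  · exact sub_eq_zero.2 hR.init
  · have hs' := hsub hs
    have b1 : ‖projT r (R s) (L s (R s)) - projT r (R s) (L s (F s))‖ ≤
        K * (‖R s - projM r (F s)‖ + ‖F s - projM r (F s)‖) := by
      rw [projT_sub]
      refine (norm_projT_le _ _).trans ((hL s hs' _ _).trans (mul_le_mul_of_nonneg_left ?_ hK))
      have := norm_sub_le (R s - projM r (F s)) (F s - projM r (F s))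
      rwa [sub_sub_sub_cancel_right] at this
    have b2 := norm_projT_sub_projT_le hr (hgap s hs') (hR.rank_eq s hs') (L s (F s))
    have b3 := hYb s hs'
    have b4 := mul_le_mul_of_nonneg_right (hgrow s hs') (norm_nonneg (R s - projM r (F s)))
    -- Three sources of error: the Lipschitz variation of 𝓛, the turning of the tangent space from P
    -- to R, and the curvature term in the derivative of P. The first two supply η‖e‖, and the first
    -- and third supply the source term.
    have e : projT r (R s) (L s (R s)) - Y s =
        (projT r (R s) (L s (R s)) - projT r (R s) (L s (F s))) +
        (projT r (R s) (L s (F s)) - projT r (projM r (F s)) (L s (F s))) -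
        (Y s - projT r (projM r (F s)) (L s (F s))) := by abel
    have b5 : ‖projT r (R s) (L s (R s)) - Y s‖ ≤ _ :=
      (congrArg norm e).le.trans ((norm_sub_le _ _).trans (add_le_add_left (norm_add_le _ _) _))
    refine b5.trans ?_
    rw [growthRate]
    rw [div_mul_eq_mul_div, mul_div_assoc] at b3
    linarith
  · exact (integrableOn_errorIntegrand hr hF hgap hη t).mono_set hsub

end Error

end LowRank

end

theorem mainTheorem2 (l m r : ℕ) (hr : 1 ≤ r) (K T : ℝ) (hT : 0 ≤ T)
    (L : ℝ → Matrix (Fin l) (Fin m) ℝ → Matrix (Fin l) (Fin m) ℝ)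
    (F R : ℝ → Matrix (Fin l) (Fin m) ℝ)
    (hF : LowRank.IsFullSolution T L F)
    (hR : LowRank.IsDOSolution r T L F R)
    (hL : ∀ t ∈ Set.Icc 0 T, ∀ A B : Matrix (Fin l) (Fin m) ℝ,
      ‖L t A - L t B‖ ≤ K * ‖A - B‖)
    (hgap : ∀ t ∈ Set.Icc 0 T, LowRank.sigma (r + 1) (F t) < LowRank.sigma r (F t))
    -- the supremum in the growth rate is finite
    (hη : BddAbove (LowRank.growthValues r T L F)) :
    ∀ t ∈ Set.Icc 0 T,
      IntervalIntegrable (LowRank.errorIntegrand r K T L F t) MeasureTheory.volume 0 t ∧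
      ‖R t - LowRank.projM r (F t)‖ ≤ ∫ s in (0 : ℝ)..t, LowRank.errorIntegrand r K T L F t s := by
  intro t ht
  refine ⟨?_, hR.norm_sub_projM_le hr hF hL hgap hη ht⟩
  rw [intervalIntegrable_iff_integrableOn_Icc_of_le ht.1]
  exact (LowRank.integrableOn_errorIntegrand hr hF hgap hη t).mono_set
    (Set.Icc_subset_Icc_right ht.2)
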